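/- Let $\mathcal O\subset\mathbb R^2$ be a bounded domain, $T>0$, $\mu>0$, $\alpha,\beta\ge 0$. Let $\mathcal V$ be the space of divergence-free fields in $C_0^\infty(\mathcal O;\mathbb R^2)$, and let $\mathbb H$ and $\mathbb V$ be the closures of $\mathcal V$ in $L^2(\mathcal O;\mathbb R^2)$ and in $H^1_0(\mathcal O;\mathbb R^2)$; $\mathbb V'$ is the dual of $\mathbb V$, $\langle\cdot,\cdot\rangle$ is the duality extending the inner product $(\cdot,\cdot)$ of $\mathbb H$, and $\mathbb V\subset\mathbb H\subset\mathbb V'$. Let $\mathbb U$ be a separable real Hilbert space, $\mathrm D:\mathbb U\to\mathbb V'$ bounded and linear, and $\mathrm D^*:\mathbb V\to\mathbb U$ its adjoint, $(\mathrm U,\mathrm D^*v)_{\mathbb U}=\langle \mathrm D\mathrm U,v\rangle$. For $\mathbf u,\mathbf v,\mathbf w\in\mathbb V$ put $$\langle \mathrm A\mathbf u,\mathbf v\rangle=\int_{\mathcal O}\nabla\mathbf u:\nabla\mathbf v\,dx,\qquad \langle \mathrm B(\mathbf u,\mathbf v),\mathbf w\rangle=\int_{\mathcal O}(\mathbf u\cdot\nabla)\mathbf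 v\cdot\mathbf w\,dx,\qquad \langle\mathcal C(\mathbf u),\mathbf v\rangle=\int_{\mathcal O}|\mathbf u|^{2}\,\mathbf u\cdot\mathbf v\,dx ,$$ which is the case $r=3$ of the absorption term $|\mathbf u|^{r-1}\mathbf u$, and $\langle\mathcal C'(\mathbf u)\mathbf p,\mathbf q\rangle=\int_{\mathcal O}\big(|\mathbf u|^2\,\mathbf p\cdot\mathbf q+2(\mathbf u\cdot\mathbf p)(\mathbf u\cdot\mathbf q)\big)dx$, $\langle(\mathrm B'(\mathbf u))^*\mathbf p,\mathbf q\rangle=\langle \mathrm B(\mathbf u,\mathbf q)+\mathrm B(\mathbf q,\mathbf u),\mathbf p\rangle$. Let $\mathbf f\in L^2(0,T;\mathbb V')$, $\mathbf u_0,\mathbf u^f\in\mathbb H$, $\mathbf u_d\in L^2(0,T;\mathbb H)$. The admissible class $\mathscr A_{\mathrm{ad}}$ is the set of pairs $(\mathbf u,\mathrm U)$ with $\mathrm U\in L^2(0,T;\mathbb U)$ and $\mathbf u\in C([0,T];\mathbb H)\cap L^2(0,T;\mathbb V)$ a weak solution of $$\partial_t\mathbf u+\mu\mathrm A\mathbf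 u+\mathrm B(\mathbf u,\mathbf u)+\alpha\mathbf u+\beta\,\mathcal C(\mathbf u)=\mathbf f+\mathrm D\mathrm U\ \text{ in }\mathbb V'\text{ for a.e. }t\in[0,T],\qquad \mathbf u(0)=\mathbf u_0,$$ that is, the equation holds with $\partial_t\mathbf u\in L^{4/3}(0,T;\mathbb V')$, $\lim_{t\downarrow0}(\mathbf u(t),\mathbf v)=(\mathbf u_0,\mathbf v)$ for all $\mathbf v\in\mathbb V$, and for all $t\in[0,T]$ the energy equality $$\|\mathbf u(t)\|_{\mathbb H}^2+2\mu\int_0^t\|\nabla\mathbf u\|_{\mathbb H}^2ds+2\alpha\int_0^t\|\mathbf u\|_{\mathbb H}^2ds+2\beta\int_0^t\|\mathbf u\|_{L^4}^4ds=\|\mathbf u_0\|_{\mathbb H}^2+2\int_0^t\langle\mathbf f,\mathbf u\rangle ds+2\int_0^t\langle\mathrm D\mathrm U,\mathbf u\rangle ds$$ holds. Problem (P) is to minimise over $(\mathbf u,\mathrm U)\in\mathscr A_{\mathrm{ad}}$ the cost $$\mathscr J(\mathbf u,\mathrm U)=\tfrac12\int_0^T\|\mathbf u-\mathbf u_d\|_{\mathbb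 H}^2dt+\tfrac12\int_0^T\|\nabla\mathbf u\|_{\mathbb H}^2dt+\tfrac12\int_0^T\|\mathrm U\|_{\mathbb U}^2dt+\tfrac12\|\mathbf u(T)-\mathbf u^f\|_{\mathbb H}^2 .$$ **Theorem (second order sufficient condition, $r=3$).** Let $(\mathbf u^*,\mathrm U^*)\in\mathscr A_{\mathrm{ad}}$, and let $\mathbf p\in C([0,T];\mathbb H)\cap L^2(0,T;\mathbb V)$ with $\partial_t\mathbf p\in L^{4/3}(0,T;\mathbb V')$ be a weak solution of the adjoint system $$-\partial_t\mathbf p+\mu\mathrm A\mathbf p+(\mathrm B'(\mathbf u^*))^*\mathbf p+\alpha\mathbf p+\beta\,\mathcal C'(\mathbf u^*)\mathbf p=(\mathbf u^*-\mathbf u_d)-\Delta\mathbf u^*\ \text{ in }\mathbb V'\text{ for a.e. }t,\qquad \mathbf p(T)=\mathbf u^*(T)-\mathbf u^f,$$ where $\langle-\Delta\mathbf u^*,\mathbf q\rangle=\int_{\mathcal O}\nabla\mathbf u^*:\nabla\mathbf q\,dx$. Suppose that $\mathrm U^*(t)=-\mathrm D^*\mathbf p(t)$ for a.e. $t\in[0,T]$,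 and that for every $(\mathbf u,\mathrm U)\in\mathscr A_{\mathrm{ad}}-\{(\mathbf u^*,\mathrm U^*)\}$ (the differences of feasible pairs with $(\mathbf u^*,\mathrm U^*)$) $$\tfrac12\int_0^T\!\big(\|\mathbf u\|_{\mathbb H}^2+\|\nabla\mathbf u\|_{\mathbb H}^2+\|\mathrm U\|_{\mathbb U}^2\big)dt+\tfrac12\|\mathbf u(T)\|_{\mathbb H}^2-\int_0^T\!\langle\mathrm B(\mathbf u,\mathbf u),\mathbf p\rangle dt-\beta\int_0^T\!\big\langle2(\mathbf u^*\cdot\mathbf u)\mathbf u+|\mathbf u|^2(\mathbf u+\mathbf u^*),\mathbf p\big\rangle dt\ \ge\ 0 .$$ Then $(\mathbf u^*,\mathrm U^*)$ is an optimal pair for problem (P). -/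

import Mathlib

open MeasureTheory Set Filter Topology
open scoped ContDiff ENNReal RealInnerProductSpace Pointwise

noncomputable section

namespace CBF

/-- Points of the plane, and values of planar vector fields. -/
abbrev E2 : Type := EuclideanSpace ℝ (Fin 2)

/-- Values of gradients of planar vector fields: the entry `(i, j)` is `∂ u_j / ∂ x_i`.
The norm is the Frobenius norm. -/
abbrev M2 : Type := EuclideanSpace ℝ (Fin 2 × Fin 2)

/-- `L²(O; ℝ²)`. -/
abbrev L2Vec (O : Set E2) : Type := Lp E2 2 (volume.restrict O)

/-- `L²(O; ℝ^{2 × 2})`. -/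
abbrev L2Mat (O : Set E2) : Type := Lp M2 2 (volume.restrict O)

/-- The classical gradient of a vector field, `(i, j) ↦ ∂ φ_j / ∂ x_i`. -/
def gradField (φ : E2 → E2) (x : E2) : M2 :=
  WithLp.toLp 2 fun ij => fderiv ℝ φ x (EuclideanSpace.single ij.1 1) ij.2

/-- The classical divergence of a vector field. -/
def divField (φ : E2 → E2) (x : E2) : ℝ :=
  ∑ i, fderiv ℝ φ x (EuclideanSpace.single i 1) i

lemma gradField_add {φ ψ : E2 → E2} (hφ : ContDiff ℝ ∞ φ) (hψ : ContDiff ℝ ∞ ψ) :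
    gradField (φ + ψ) = gradField φ + gradField ψ := by
  funext x
  ext ij
  have h1 : DifferentiableAt ℝ φ x := (hφ.differentiable (by simp)) x
  have h2 : DifferentiableAt ℝ ψ x := (hψ.differentiable (by simp)) x
  simp [gradField, fderiv_add h1 h2]

lemma gradField_smul (c : ℝ) {φ : E2 → E2} (hφ : ContDiff ℝ ∞ φ) :
    gradField (c • φ) = c • gradField φ := by
  funext x
  ext ij
  have h1 : DifferentiableAt ℝ φ x := (hφ.differentiable (by simp)) x
  simp [gradField, fderiv_const_smul h1 c]

/-- The space of divergence-free smooth vector fields with compact support in `O`. -/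
def testFields (O : Set E2) : Submodule ℝ (E2 → E2) where
  carrier := {φ | ContDiff ℝ ∞ φ ∧ HasCompactSupport φ ∧ tsupport φ ⊆ O ∧
    ∀ x, divField φ x = 0}
  zero_mem' := by
    refine ⟨contDiff_const, HasCompactSupport.zero, ?_, ?_⟩
    · have : tsupport (0 : E2 → E2) = ∅ := tsupport_eq_empty_iff.2 rfl
      simp [this]
    · intro x
      simp [divField]
  add_mem' := by
    rintro φ ψ ⟨h1, h2, h3, h4⟩ ⟨k1, k2, k3, k4⟩
    refine ⟨h1.add k1, h2.add k2, (tsupport_add φ ψ).trans (union_subset h3 k3), ?_⟩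
    intro x
    have e1 : DifferentiableAt ℝ φ x := (h1.differentiable (by simp)) x
    have e2 : DifferentiableAt ℝ ψ x := (k1.differentiable (by simp)) x
    have a := h4 x
    have b := k4 x
    simp only [divField, Fin.sum_univ_two] at a b
    simp only [divField, fderiv_add e1 e2, Fin.sum_univ_two, _root_.add_apply,
      PiLp.add_apply]
    linarith
  smul_mem' := by
    rintro c φ ⟨h1, h2, h3, h4⟩
    refine ⟨contDiff_const.smul h1, h2.smul_left (f := fun _ => c),
      (tsupport_smul_subset_right (fun _ => c) φ).trans h3, ?_⟩
    intro x
    have e1 : DifferentiableAt ℝ φ x := (h1.differentiable (by simp)) x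
    have a := h4 x
    simp only [divField, Fin.sum_univ_two] at a
    simp only [divField, fderiv_const_smul e1 c, Fin.sum_univ_two,
      _root_.smul_apply, PiLp.smul_apply, smul_eq_mul]
    rw [← mul_add, a, mul_zero]

lemma continuous_gradField {φ : E2 → E2} (h : ContDiff ℝ ∞ φ) : Continuous (gradField φ) := by
  have h1 : Continuous (fderiv ℝ φ) := h.continuous_fderiv (by simp)
  unfold gradField
  refine (PiLp.continuous_toLp 2 _).comp (continuous_pi fun ij => ?_)
  have h2 : Continuous fun x => fderiv ℝ φ x (EuclideanSpace.single ij.1 1) :=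
    h1.clm_apply continuous_const
  fun_prop

lemma hasCompactSupport_gradField {φ : E2 → E2} (h : HasCompactSupport φ) :
    HasCompactSupport (gradField φ) := by
  refine (h.fderiv (𝕜 := ℝ)).mono ?_
  intro x hx hx'
  apply hx
  ext ij
  simp [gradField, hx']

lemma memLp_testField {O : Set E2} (φ : testFields O) :
    MemLp (φ : E2 → E2) 2 (volume.restrict O) :=
  (φ.2.1.continuous.memLp_of_hasCompactSupport φ.2.2.1).restrict O

lemma memLp_gradField {O : Set E2} (φ : testFields O) :
    MemLp (gradField φ) 2 (volume.restrict O) :=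
  ((continuous_gradField φ.2.1).memLp_of_hasCompactSupport
    (hasCompactSupport_gradField φ.2.2.1)).restrict O

/-- A test field, as an element of `L²(O; ℝ²)`. -/
def testToL2 (O : Set E2) : testFields O →ₗ[ℝ] L2Vec O where
  toFun φ := (memLp_testField φ).toLp _
  map_add' φ ψ := MemLp.toLp_add (memLp_testField φ) (memLp_testField ψ)
  map_smul' c φ := MemLp.toLp_const_smul c (memLp_testField φ)

/-- The gradient of a test field, as an element of `L²(O; ℝ^{2 × 2})`. -/
def testGradToL2 (O : Set E2) : testFields O →ₗ[ℝ] L2Mat O where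
  toFun φ := (memLp_gradField φ).toLp _
  map_add' φ ψ := by
    rw [← MemLp.toLp_add (memLp_gradField φ) (memLp_gradField ψ)]
    exact MemLp.toLp_congr _ _ (by simp [gradField_add φ.2.1 ψ.2.1])
  map_smul' c φ := by
    rw [RingHom.id_apply, ← MemLp.toLp_const_smul c (memLp_gradField φ)]
    exact MemLp.toLp_congr _ _ (by simp [gradField_smul c φ.2.1])

/-- The pair `(φ, ∇φ)` of a test field and its gradient; the norm of the pair is the `H¹(O)` norm
`(‖φ‖² + ‖∇φ‖²)^{1/2}`. -/
def testToH1 (O : Set E2) : testFields O →ₗ[ℝ] WithLp 2 (L2Vec O × L2Mat O) :=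
  (WithLp.linearEquiv 2 ℝ (L2Vec O × L2Mat O)).symm.toLinearMap ∘ₗ
    (testToL2 O).prod (testGradToL2 O)

/-- The space `ℍ`: the closure of the test fields in `L²(O; ℝ²)`. -/
def HSub (O : Set E2) : Submodule ℝ (L2Vec O) :=
  (LinearMap.range (testToL2 O)).topologicalClosure

/-- The space `ℍ` as a Hilbert space. -/
abbrev H (O : Set E2) : Type := HSub O

/-- The space `𝕍`: the closure of the test fields in `H¹(O; ℝ²)`. An element is stored as the pair
of the field and its (weak) gradient. On a bounded `O` the norm of `𝕍` used here is equivalent to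
`‖∇u‖`, by the Poincaré inequality. -/
def VSub (O : Set E2) : Submodule ℝ (WithLp 2 (L2Vec O × L2Mat O)) :=
  (LinearMap.range (testToH1 O)).topologicalClosure

/-- The space `𝕍` as a Hilbert space. -/
abbrev V (O : Set E2) : Type := VSub O

/-- The dual space `𝕍'`. -/
abbrev VDual (O : Set E2) : Type := StrongDual ℝ (V O)

variable {O : Set E2}

/-- The (weak) gradient of an element of `𝕍`. -/
def grad (v : V O) : L2Mat O := (v : WithLp 2 (L2Vec O × L2Mat O)).snd

lemma fst_mem_HSub (v : V O) : (v : WithLp 2 (L2Vec O × L2Mat O)).fst ∈ HSub O := by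
  have hc : Continuous fun z : WithLp 2 (L2Vec O × L2Mat O) => z.fst :=
    (WithLp.fstL 2 ℝ (L2Vec O) (L2Mat O)).continuous
  have hv : (v : WithLp 2 (L2Vec O × L2Mat O)) ∈
      closure ((LinearMap.range (testToH1 O) : Submodule ℝ _) : Set _) := v.2
  refine map_mem_closure hc hv ?_
  rintro _ ⟨φ, rfl⟩
  exact ⟨φ, rfl⟩

/-- The embedding `𝕍 ⊂ ℍ`. -/
def VtoH (O : Set E2) : V O →L[ℝ] H O :=
  ((WithLp.fstL 2 ℝ (L2Vec O) (L2Mat O)).comp (VSub O).subtypeL).codRestrict (HSub O)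
    fst_mem_HSub

/-- The underlying vector field `O → ℝ²` of an element of `𝕍`. -/
def field (v : V O) : E2 → E2 := ((VtoH O v : H O) : L2Vec O)

/-- The embedding `ℍ ⊂ 𝕍'`, `h ↦ (v ↦ (h, v))`. -/
def HtoVDual (O : Set E2) (h : H O) : VDual O := (innerSL ℝ h).comp (VtoH O)

/-- `⟨A u, v⟩ = ∫_O ∇u : ∇v`; since `v` vanishes on the boundary this is also `⟨-Δu, v⟩`. -/
def stokesForm (u v : V O) : ℝ := ⟪grad u, grad v⟫

/-- The trilinear form `b(u, v, w) = ∫_O ∑_{i,j} u_i (∂ v_j / ∂ x_i) w_j`; it is the pairing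
`⟨B(u, v), w⟩`. -/
def trilin (u v w : V O) : ℝ :=
  ∫ x in O, ∑ i, ∑ j, field u x i * grad v x (i, j) * field w x j

/-- The pairing `⟨C(u), v⟩` for `C(u) = 𝒫(|u|² u)`. -/
def cubicForm (u v : V O) : ℝ :=
  ∫ x in O, ⟪‖field u x‖ ^ 2 • field u x, field v x⟫

/-- The pairing `⟨C'(u) p, q⟩` for `C'(u) p = 𝒫(|u|² p) + 2 𝒫(u (u · p))`. -/
def cubicDerivForm (u p q : V O) : ℝ :=
  ∫ x in O, ⟪‖field u x‖ ^ 2 • field p x + (2 * ⟪field u x, field p x⟫) • field u x, field q x⟫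

/-- The pairing `⟨2 (a · w) w + |w|² (w + a), p⟩`. -/
def cubicRemainderForm (a w p : V O) : ℝ :=
  ∫ x in O, ⟪(2 * ⟪field a x, field w x⟫) • field w x
    + ‖field w x‖ ^ 2 • (field w x + field a x), field p x⟫

/-- `∫_O |u|⁴`, the fourth power of the `L⁴` norm. -/
def quartic (u : V O) : ℝ := ∫ x in O, ‖field u x‖ ^ 4

/-- Lebesgue measure on the time interval from `0` to `T`. -/
abbrev timeMeasure (T : ℝ) : Measure ℝ := volume.restrict (Ioc 0 T)

/-- The space `C([0, T]; ℍ) ∩ L²(0, T; 𝕍)`. An element is stored as a pair `(u, û)`, where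
`u` is the trajectory in `ℍ`, continuous on `[0, T]`, and `û` is the same trajectory with values in
`𝕍`, square integrable, and equal to `u` for almost every time. -/
def stateSub (O : Set E2) (T : ℝ) : Submodule ℝ ((ℝ → H O) × (ℝ → V O)) where
  carrier := {u | ContinuousOn u.1 (Icc 0 T) ∧ MemLp u.2 2 (timeMeasure T) ∧
    ∀ᵐ t ∂timeMeasure T, VtoH O (u.2 t) = u.1 t}
  zero_mem' := ⟨continuousOn_const, MemLp.zero, by simp⟩
  add_mem' := by
    rintro u v ⟨h1, h2, h3⟩ ⟨k1, k2, k3⟩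
    refine ⟨h1.add k1, h2.add k2, ?_⟩
    filter_upwards [h3, k3] with t ht kt
    simp [ht, kt]
  smul_mem' := by
    rintro c u ⟨h1, h2, h3⟩
    refine ⟨h1.const_smul c, h2.const_smul c, ?_⟩
    filter_upwards [h3] with t ht
    simp [ht]

/-- The space `C([0, T]; ℍ) ∩ L²(0, T; 𝕍)`. -/
abbrev State (O : Set E2) (T : ℝ) : Type := stateSub O T

/-- The value in `ℍ` of a trajectory. -/
def State.inH {T : ℝ} (u : State O T) (t : ℝ) : H O := u.1.1 t

/-- The value in `𝕍` of a trajectory. -/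
def State.inV {T : ℝ} (u : State O T) (t : ℝ) : V O := u.1.2 t

/-- `g` is the weak time derivative of `u` on `(0, T)`, in the sense of `𝕍'`-valued
distributions. -/
def HasWeakTimeDeriv {T : ℝ} (u : State O T) (g : ℝ → VDual O) : Prop :=
  ∀ φ : ℝ → ℝ, ContDiff ℝ ∞ φ → HasCompactSupport φ → tsupport φ ⊆ Ioo 0 T →
    ∫ t in 0..T, deriv φ t • HtoVDual O (u.inH t) = -∫ t in 0..T, φ t • g t

variable {𝕌 : Type*} [NormedAddCommGroup 𝕌] [InnerProductSpace ℝ 𝕌]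

/-- The space of controls `L²(0, T; 𝕌)`. -/
abbrev Control (T : ℝ) (𝕌 : Type*) [NormedAddCommGroup 𝕌] : Type _ := Lp 𝕌 2 (timeMeasure T)

/-- `u` is a weak solution, with exponent `r = 3` and control `U`, of
`∂ₜu + μ A u + B(u) + α u + β C(u) = f + D U` in `𝕍'`, `u(0) = u₀`: the equation holds for almost
every time, with `∂ₜu ∈ L^{4/3}(0, T; 𝕍')`, the initial value is attained weakly, and the energy
equality holds. -/
structure IsWeakSolution {T : ℝ} (μ α β : ℝ) (D : 𝕌 →L[ℝ] VDual O) (f : ℝ → VDual O) (u₀ : H O)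
    (u : State O T) (U : Control T 𝕌) : Prop where
  equation : ∃ g : ℝ → VDual O, MemLp g (4 / 3) (timeMeasure T) ∧ HasWeakTimeDeriv u g ∧
    ∀ᵐ t ∂timeMeasure T, ∀ v : V O,
      g t v + μ * stokesForm (u.inV t) v + trilin (u.inV t) (u.inV t) v
        + α * ⟪u.inH t, VtoH O v⟫ + β * cubicForm (u.inV t) v = f t v + D (U t) v
  initial : ∀ v : V O,
    Tendsto (fun t => ⟪u.inH t, VtoH O v⟫) (𝓝[>] 0) (𝓝 ⟪u₀, VtoH O v⟫)
  energy : ∀ t ∈ Icc 0 T,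
    ‖u.inH t‖ ^ 2 + 2 * μ * (∫ s in 0..t, ‖grad (u.inV s)‖ ^ 2)
        + 2 * α * (∫ s in 0..t, ‖u.inH s‖ ^ 2) + 2 * β * (∫ s in 0..t, quartic (u.inV s))
      = ‖u₀‖ ^ 2 + 2 * (∫ s in 0..t, f s (u.inV s)) + 2 * (∫ s in 0..t, D (U s) (u.inV s))

/-- The admissible class: the pairs of a control and a weak solution with that control. -/
def admissible (T : ℝ) (μ α β : ℝ) (D : 𝕌 →L[ℝ] VDual O) (f : ℝ → VDual O) (u₀ : H O) :
    Set (State O T × Control T 𝕌) :=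
  {q | IsWeakSolution μ α β D f u₀ q.1 q.2}

/-- The differences of all feasible pairs with a given feasible pair. -/
def feasibleDifferences (T : ℝ) (μ α β : ℝ) (D : 𝕌 →L[ℝ] VDual O) (f : ℝ → VDual O) (u₀ : H O)
    (q : State O T × Control T 𝕌) : Set (State O T × Control T 𝕌) :=
  admissible T μ α β D f u₀ - {q}

/-- The cost functional
`½ ∫ ‖u - u_d‖² + ½ ∫ ‖∇u‖² + ½ ∫ ‖U‖² + ½ ‖u(T) - u^f‖²`. -/
def cost {T : ℝ} (ud : ℝ → H O) (uf : H O) (q : State O T × Control T 𝕌) : ℝ :=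
  1 / 2 * (∫ t in 0..T, ‖q.1.inH t - ud t‖ ^ 2) + 1 / 2 * (∫ t in 0..T, ‖grad (q.1.inV t)‖ ^ 2)
    + 1 / 2 * (∫ t in 0..T, ‖q.2 t‖ ^ 2) + 1 / 2 * ‖q.1.inH T - uf‖ ^ 2

/-- `q` is an optimal pair: it is feasible and minimises the cost among all feasible pairs. -/
def IsOptimalPair {T : ℝ} (μ α β : ℝ) (D : 𝕌 →L[ℝ] VDual O) (f : ℝ → VDual O) (u₀ : H O)
    (ud : ℝ → H O) (uf : H O) (q : State O T × Control T 𝕌) : Prop :=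
  q ∈ admissible T μ α β D f u₀ ∧ IsMinOn (cost ud uf) (admissible T μ α β D f u₀) q

/-- `p` is a weak solution of the adjoint system
`-∂ₜp + μ A p + (B'(u))* p + α p + β C'(u) p = (u - u_d) - Δu` in `𝕍'` for almost every time,
`p(T) = u(T) - u^f`, where `⟨(B'(u))* p, q⟩ = ⟨B(u, q), p⟩ + ⟨B(q, u), p⟩`. -/
structure IsAdjointSolution {T : ℝ} (μ α β : ℝ) (ud : ℝ → H O) (uf : H O)
    (u p : State O T) : Prop where
  equation : ∃ g : ℝ → VDual O, MemLp g (4 / 3) (timeMeasure T) ∧ HasWeakTimeDeriv p g ∧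
    ∀ᵐ t ∂timeMeasure T, ∀ q : V O,
      -g t q + μ * stokesForm (p.inV t) q
        + (trilin (u.inV t) q (p.inV t) + trilin q (u.inV t) (p.inV t))
        + α * ⟪p.inH t, VtoH O q⟫ + β * cubicDerivForm (u.inV t) (p.inV t) q
      = ⟪u.inH t - ud t, VtoH O q⟫ + stokesForm (u.inV t) q
  final : p.inH T = u.inH T - uf

/-- The adjoint `D* : 𝕍 → 𝕌` of `D : 𝕌 → 𝕍'`, given by `(U, D* v) = ⟨D U, v⟩`. -/
def controlAdjoint [CompleteSpace 𝕌] (D : 𝕌 →L[ℝ] VDual O) (v : V O) : 𝕌 :=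
  (InnerProductSpace.toDual ℝ 𝕌).symm (D.flip v)

lemma inner_controlAdjoint [CompleteSpace 𝕌] (D : 𝕌 →L[ℝ] VDual O) (v : V O) (w : 𝕌) :
    ⟪w, controlAdjoint D v⟫ = D w v := by
  rw [real_inner_comm, controlAdjoint, InnerProductSpace.toDual_symm_apply]
  rfl

/-- The first order condition `U(t) = -D* p(t)` for almost every `t`. -/
def FirstOrderCondition [CompleteSpace 𝕌] {T : ℝ} (D : 𝕌 →L[ℝ] VDual O) (p : State O T)
    (U : Control T 𝕌) : Prop :=
  ∀ᵐ t ∂timeMeasure T, U t = -controlAdjoint D (p.inV t)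

/-- The second order expression at the difference `(w, W) = q`, with reference state `u`
and adjoint state `p`:
`½ ∫ (‖w‖² + ‖∇w‖² + ‖W‖²) + ½ ‖w(T)‖² - ∫ ⟨B(w, w), p⟩
- β ∫ ⟨2 (u · w) w + |w|² (w + u), p⟩`. -/
def secondOrderForm {T : ℝ} (β : ℝ) (u p : State O T) (q : State O T × Control T 𝕌) : ℝ :=
  1 / 2 * (∫ t in 0..T, (‖q.1.inH t‖ ^ 2 + ‖grad (q.1.inV t)‖ ^ 2 + ‖q.2 t‖ ^ 2))
    + 1 / 2 * ‖q.1.inH T‖ ^ 2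
    - (∫ t in 0..T, trilin (q.1.inV t) (q.1.inV t) (p.inV t))
    - β * ∫ t in 0..T, cubicRemainderForm (u.inV t) (q.1.inV t) (p.inV t)

end CBF

end

/-!
The cost is quadratic and the only other nonlinearities are the quadratic convection term and the
cubic absorption term, whose Taylor expansions at `u*` terminate. Write `w = u - u*` and
`W = U - U*` for the difference of an admissible pair with the reference pair. Expanding the cost
leaves the quadratic terms in `(w, W)` plus the first order terms
`∫ (u* - u_d, w) + ∫ (∇u*, ∇w) + ∫ (U*, W) + (w(T), u*(T) - u^f)`. Testing the adjoint equation
with `w`, the difference of the state equations with `p`, and using `U* = -D* p`, the first order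
terms turn into `-∫ ⟨B(w, w), p⟩ - β ∫ ⟨2 (u* · w) w + |w|² (w + u*), p⟩` plus
`(w(T), p(T)) - ∫ ⟨∂ₜw, p⟩ - ∫ ⟨∂ₜp, w⟩`, and the latter vanishes by integration by parts in time,
because `w(0) = 0`. Hence the cost difference is exactly the second order expression at `(w, W)`
(`CBF.cost_sub_cost_eq`), and the second order condition says that it is nonnegative.

The analytic content is the integration by parts, since `∂ₜw` and `∂ₜp` are only known to lie in
`L^{4/3}(0, T; 𝕍')` while `w` and `p` lie in `L²(0, T; 𝕍)`. It rests on two facts.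

* The Ladyzhenskaya inequality `‖v‖_{L⁴}² ≤ C ‖v‖_ℍ ‖v‖_𝕍` (`CBF.ladyzhenskaya_eLpNorm`), which
  follows from the Gagliardo–Nirenberg–Sobolev inequality for `|v|²`. With the equations it shows
  that the time derivatives satisfy `|⟨g(t), v⟩| ≤ K (m(t) ‖v‖_𝕍 + m(t)² ‖v‖_ℍ)` with a square
  integrable `m` (`CBF.HasTestBound`); this is the regularity `L²(0, T; 𝕍') + L¹(0, T; ℍ)`, dual
  to that of the trajectories. It also makes all terms of the second order expression integrable.
* An abstract product rule for such trajectories (`CBF.integral_apply_add_integral_apply`). The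
  weak derivative gives the increments `w(s) - w(r) = ∫_r^s g`
  (`CBF.sub_eq_integral_of_weakDeriv`), the discrete product rule is averaged over the time
  interval, and the step tends to zero by the continuity of translations in `L²(0, T; 𝕍)` and the
  uniform continuity in `ℍ`.
-/

noncomputable section

open scoped NNReal

namespace CBF

variable {O : Set E2}

/-! ### The Ladyzhenskaya inequality -/

/-- The operator norm of the derivative is controlled by the Frobenius norm of the gradient. -/
lemma norm_fderiv_le_gradField (φ : E2 → E2) (x : E2) :
    ‖fderiv ℝ φ x‖ ≤ 2 * ‖gradField φ x‖ := by
  have hcol : ∀ i : Fin 2,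
      ‖fderiv ℝ φ x (EuclideanSpace.single i 1)‖ ≤ ‖gradField φ x‖ := by
    intro i
    rw [EuclideanSpace.norm_eq, EuclideanSpace.norm_eq]
    apply Real.sqrt_le_sqrt
    rw [Fintype.sum_prod_type]
    exact Finset.single_le_sum
      (f := fun k : Fin 2 => ∑ j, ‖gradField φ x (k, j)‖ ^ 2)
      (fun k _ => Finset.sum_nonneg fun j _ => by positivity) (Finset.mem_univ i)
  refine ContinuousLinearMap.opNorm_le_bound _ (by positivity) fun y => ?_
  have hy : y = ∑ i, y i • (EuclideanSpace.single i (1 : ℝ) : E2) := by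
    ext j
    fin_cases j <;> simp [Fin.sum_univ_two]
  calc ‖fderiv ℝ φ x y‖
      = ‖∑ i, y i • fderiv ℝ φ x (EuclideanSpace.single i 1)‖ := by
        conv_lhs => rw [hy]
        simp
    _ ≤ ∑ i : Fin 2, ‖y‖ * ‖gradField φ x‖ := by
        refine norm_sum_le_of_le _ fun i _ => ?_
        rw [norm_smul]
        exact mul_le_mul (PiLp.norm_apply_le y i) (hcol i) (norm_nonneg _) (norm_nonneg _)
    _ = 2 * ‖gradField φ x‖ * ‖y‖ := by
        simp only [Finset.sum_const, Finset.card_univ, Fintype.card_fin, nsmul_eq_mul]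
        push_cast
        ring

/-- The constant in the Ladyzhenskaya inequality. -/
def ladyzhenskayaConst : ℝ≥0 := eLpNormLESNormFDerivOneConst (volume : Measure E2) 2 * 4

instance : ENNReal.HolderTriple 4 4 2 := ⟨by
  rw [← two_mul, show (4 : ℝ≥0∞) = 2 * 2 by norm_num,
    ENNReal.mul_inv (by norm_num) (by norm_num), ← mul_assoc,
    ENNReal.mul_inv_cancel (by norm_num) (by norm_num), one_mul]⟩

/-- The Ladyzhenskaya inequality for test fields: the Gagliardo–Nirenberg–Sobolev inequality
`‖ψ‖_{L²} ≤ C ‖∇ψ‖_{L¹}` of the plane, applied to `ψ = |φ|²`. -/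
lemma ladyzhenskaya_testField (φ : testFields O) :
    eLpNorm (φ : E2 → E2) 4 (volume.restrict O) ^ (2 : ℝ) ≤
      ladyzhenskayaConst * (eLpNorm (φ : E2 → E2) 2 (volume.restrict O)
        * eLpNorm (gradField φ) 2 (volume.restrict O)) := by
  obtain ⟨φ, hφ, hc, hs, -⟩ := φ
  dsimp only
  set ψ : E2 → ℝ := fun x => ‖φ x‖ ^ 2 with hψ
  have hψs : ContDiff ℝ 1 ψ := (hφ.norm_sq ℝ).of_le (by simp)
  have hψc : HasCompactSupport ψ := hc.mono fun x hx hx' => hx (by simp [hψ, hx'])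
  have hd : ∀ x, ‖fderiv ℝ ψ x‖ ≤ 4 * (‖φ x‖ * ‖gradField φ x‖) := by
    intro x
    have h1 : DifferentiableAt ℝ φ x := (hφ.differentiable (by simp)) x
    have h2 : fderiv ℝ ψ x = 2 • (innerSL ℝ (φ x)).comp (fderiv ℝ φ x) :=
      h1.hasFDerivAt.norm_sq.fderiv
    rw [h2]
    calc ‖2 • (innerSL ℝ (φ x)).comp (fderiv ℝ φ x)‖
        ≤ 2 * ‖(innerSL ℝ (φ x)).comp (fderiv ℝ φ x)‖ := by
          simpa using norm_nsmul_le (n := 2) (a := (innerSL ℝ (φ x)).comp (fderiv ℝ φ x))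
      _ ≤ 2 * (‖φ x‖ * (2 * ‖gradField φ x‖)) := by
          gcongr
          refine (ContinuousLinearMap.opNorm_comp_le _ _).trans ?_
          rw [innerSL_apply_norm]
          gcongr
          exact norm_fderiv_le_gradField φ x
      _ = 4 * (‖φ x‖ * ‖gradField φ x‖) := by ring
  have hsupp : Function.support (fderiv ℝ ψ) ⊆ O :=
    (subset_tsupport _).trans <| (tsupport_fderiv_subset ℝ).trans <|
      (closure_mono (s := Function.support ψ) (t := Function.support φ)
        fun x hx hx' => hx (by simp [hψ, hx'])).trans hs
  have hGNS := eLpNorm_le_eLpNorm_fderiv_one (volume : Measure E2) hψs hψc (p := 2)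
    (by
      rw [finrank_euclideanSpace_fin]
      exact ⟨by norm_num, by norm_num, by norm_num⟩)
  have hHolder : eLpNorm (fun x => ‖φ x‖ * ‖gradField φ x‖) 1 (volume.restrict O) ≤
      eLpNorm φ 2 (volume.restrict O) * eLpNorm (gradField φ) 2 (volume.restrict O) := by
    have := eLpNorm_le_eLpNorm_mul_eLpNorm_of_nnnorm (p := 2) (q := 2) (r := 1)
      (μ := volume.restrict O) (f := φ) (g := gradField φ)
      hφ.continuous.aestronglyMeasurable (continuous_gradField hφ).aestronglyMeasurable
      (fun a b => ‖a‖ * ‖b‖) 1 (Eventually.of_forall fun x => by simp)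
    simpa using this
  calc eLpNorm φ 4 (volume.restrict O) ^ (2 : ℝ)
      = eLpNorm ψ 2 (volume.restrict O) := by
        have := eLpNorm_norm_rpow (p := 2) (μ := volume.restrict O) φ (q := 2) (by norm_num)
        rw [show (4 : ℝ≥0∞) = 2 * ENNReal.ofReal 2 by
          rw [ENNReal.ofReal_ofNat]; norm_num, ← this]
        simp [hψ]
    _ ≤ eLpNorm ψ 2 volume := eLpNorm_restrict_le _ _ _ _
    _ ≤ eLpNormLESNormFDerivOneConst (volume : Measure E2) 2 * eLpNorm (fderiv ℝ ψ) 1 volume :=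
        hGNS
    _ = eLpNormLESNormFDerivOneConst (volume : Measure E2) 2
          * eLpNorm (fderiv ℝ ψ) 1 (volume.restrict O) := by
        rw [eLpNorm_restrict_eq_of_support_subset (f := fderiv ℝ ψ) hsupp]
    _ ≤ eLpNormLESNormFDerivOneConst (volume : Measure E2) 2
          * ((4 : ℝ≥0) • eLpNorm (fun x => ‖φ x‖ * ‖gradField φ x‖) 1 (volume.restrict O)) := by
        gcongr
        refine eLpNorm_le_nnreal_smul_eLpNorm_of_ae_le_mul (Eventually.of_forall fun x => ?_) 1
        rw [← NNReal.coe_le_coe]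
        simpa using hd x
    _ ≤ _ := by
        rw [ladyzhenskayaConst, ENNReal.smul_def, smul_eq_mul, ENNReal.coe_mul, mul_assoc]
        gcongr

lemma coeFn_testToL2 (φ : testFields O) :
    (testToL2 O φ : E2 → E2) =ᵐ[volume.restrict O] φ :=
  MemLp.coeFn_toLp (memLp_testField φ)

/-- The Ladyzhenskaya inequality on `𝕍`. It passes from test fields to their closure by Fatou's
lemma. -/
lemma ladyzhenskaya_eLpNorm (v : V O) :
    eLpNorm (field v) 4 (volume.restrict O) ^ (2 : ℝ) ≤
      ladyzhenskayaConst * ENNReal.ofReal (‖VtoH O v‖ * ‖v‖) := by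
  have hv : (v : WithLp 2 (L2Vec O × L2Mat O)) ∈
      closure ((LinearMap.range (testToH1 O) : Submodule ℝ _) : Set _) := v.2
  obtain ⟨x, hx, hlim⟩ := mem_closure_iff_seq_limit.1 hv
  choose φ hφ using hx
  have hfst : Tendsto (fun n => testToL2 O (φ n)) atTop (𝓝 (VtoH O v : L2Vec O)) := by
    have := ((WithLp.fstL 2 ℝ (L2Vec O) (L2Mat O)).continuous.tendsto _).comp hlim
    refine this.congr fun n => ?_
    simp only [Function.comp, ← hφ n]
    rfl
  obtain ⟨ns, hns, hae⟩ := (tendstoInMeasure_of_tendsto_Lp hfst).exists_seq_tendsto_ae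
  have hLp : ∀ n, eLpNorm (testToL2 O (φ n) : E2 → E2) 4 (volume.restrict O) ^ (2 : ℝ) ≤
      ladyzhenskayaConst * ENNReal.ofReal (‖testToL2 O (φ n)‖ * ‖x n‖) := by
    intro n
    rw [eLpNorm_congr_ae (coeFn_testToL2 (φ n))]
    refine (ladyzhenskaya_testField (φ n)).trans ?_
    rw [ENNReal.ofReal_mul (norm_nonneg _)]
    gcongr
    · rw [← eLpNorm_congr_ae (coeFn_testToL2 (φ n)), ofReal_norm, Lp.enorm_def]
    · have h1 : eLpNorm (gradField (φ n)) 2 (volume.restrict O) = ‖testGradToL2 O (φ n)‖ₑ := by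
        rw [Lp.enorm_def]
        exact (eLpNorm_congr_ae (MemLp.coeFn_toLp (memLp_gradField (φ n)))).symm
      rw [h1, ← ofReal_norm]
      apply ENNReal.ofReal_le_ofReal
      rw [← hφ n]
      exact WithLp.norm_snd_le _ (testToH1 O (φ n))
  have hFatou := Lp.eLpNorm_lim_le_liminf_eLpNorm (p := 4) (μ := volume.restrict O)
    (f := fun n => (testToL2 O (φ (ns n)) : E2 → E2))
    (fun n => Lp.aestronglyMeasurable _) (field v) hae
  have hroot : ∀ n, eLpNorm (testToL2 O (φ n) : E2 → E2) 4 (volume.restrict O) ≤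
      (ladyzhenskayaConst * ENNReal.ofReal (‖testToL2 O (φ n)‖ * ‖x n‖)) ^ (2⁻¹ : ℝ) := fun n =>
    (ENNReal.le_rpow_inv_iff (by norm_num)).2 (hLp n)
  have hnorm : Tendsto (fun n => (ladyzhenskayaConst *
        ENNReal.ofReal (‖testToL2 O (φ (ns n))‖ * ‖x (ns n)‖)) ^ (2⁻¹ : ℝ)) atTop
      (𝓝 ((ladyzhenskayaConst * ENNReal.ofReal (‖VtoH O v‖ * ‖v‖)) ^ (2⁻¹ : ℝ))) := by
    refine (ENNReal.continuous_rpow_const.tendsto _).comp ?_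
    refine ENNReal.Tendsto.const_mul ?_ (Or.inr ENNReal.coe_ne_top)
    refine (ENNReal.continuous_ofReal.tendsto _).comp ?_
    exact (hfst.norm.mul hlim.norm).comp hns.tendsto_atTop
  rw [← ENNReal.le_rpow_inv_iff (by norm_num)]
  refine hFatou.trans ?_
  rw [← hnorm.liminf_eq]
  exact liminf_le_liminf (Eventually.of_forall fun n => hroot (ns n))

lemma memLp_field (v : V O) : MemLp (field v) 4 (volume.restrict O) := by
  refine ⟨Lp.aestronglyMeasurable _, ?_⟩
  have h := (ladyzhenskaya_eLpNorm v).trans_lt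
    (ENNReal.mul_lt_top ENNReal.coe_lt_top ENNReal.ofReal_lt_top)
  exact (ENNReal.rpow_lt_top_iff_of_pos (by norm_num)).1 h

lemma norm_VtoH_le (v : V O) : ‖VtoH O v‖ ≤ ‖v‖ :=
  WithLp.norm_fst_le _ (v : WithLp 2 (L2Vec O × L2Mat O))

lemma norm_grad_le (v : V O) : ‖grad v‖ ≤ ‖v‖ :=
  WithLp.norm_snd_le _ (v : WithLp 2 (L2Vec O × L2Mat O))

instance : Fact ((1 : ℝ≥0∞) ≤ 4) := ⟨by norm_num⟩

/-- `L⁴(O; ℝ²)`. -/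
abbrev L4Vec (O : Set E2) : Type := Lp E2 4 (volume.restrict O)

lemma field_add (u v : V O) : field (u + v) =ᵐ[volume.restrict O] field u + field v := by
  simp only [field, map_add, Submodule.coe_add]
  exact Lp.coeFn_add _ _

lemma field_smul (c : ℝ) (u : V O) : field (c • u) =ᵐ[volume.restrict O] c • field u := by
  simp only [field, map_smul, Submodule.coe_smul]
  exact Lp.coeFn_smul _ _

/-- The Ladyzhenskaya inequality in terms of real numbers. -/
lemma norm_toLp_field_sq_le (v : V O) :
    ‖(memLp_field v).toLp (field v)‖ ^ 2 ≤ ladyzhenskayaConst * (‖VtoH O v‖ * ‖v‖) := by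
  rw [Lp.norm_toLp, ← ENNReal.toReal_pow]
  refine ENNReal.toReal_le_of_le_ofReal (by positivity) ?_
  have := ladyzhenskaya_eLpNorm v
  rw [ENNReal.rpow_ofNat] at this
  rwa [ENNReal.ofReal_mul (by positivity), ENNReal.ofReal_coe_nnreal]

/-- The embedding `𝕍 ⊂ L⁴(O; ℝ²)`. -/
def toL4 (O : Set E2) : V O →L[ℝ] L4Vec O :=
  LinearMap.mkContinuous
    { toFun := fun v => (memLp_field v).toLp (field v)
      map_add' := fun u v => by
        rw [← MemLp.toLp_add]
        exact MemLp.toLp_congr _ _ (field_add u v)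
      map_smul' := fun c u => by
        rw [RingHom.id_apply, ← MemLp.toLp_const_smul]
        exact MemLp.toLp_congr _ _ (field_smul c u) }
    (Real.sqrt ladyzhenskayaConst) (fun v => by
      refine abs_le_of_sq_le_sq' ?_ (by positivity) |>.2
      rw [mul_pow, Real.sq_sqrt (by positivity)]
      refine (norm_toLp_field_sq_le v).trans ?_
      rw [sq ‖v‖]
      gcongr
      exact norm_VtoH_le v)

lemma coeFn_toL4 (v : V O) : (toL4 O v : E2 → E2) =ᵐ[volume.restrict O] field v :=
  MemLp.coeFn_toLp (memLp_field v)

lemma norm_toL4_sq_le (v : V O) :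
    ‖toL4 O v‖ ^ 2 ≤ ladyzhenskayaConst * (‖VtoH O v‖ * ‖v‖) :=
  norm_toLp_field_sq_le v

end CBF

namespace CBF

variable {O : Set E2}

/-! ### The trilinear and the cubic forms -/

/-- The outer product `a ⊗ b` of planar vectors, as a continuous bilinear map. -/
def outer : E2 →L[ℝ] E2 →L[ℝ] M2 :=
  LinearMap.mkContinuous₂
    (LinearMap.mk₂ ℝ (fun a b => (WithLp.toLp 2 fun ij : Fin 2 × Fin 2 => a ij.1 * b ij.2 : M2))
      (fun a a' b => by ext ij; simp [add_mul])
      (fun c a b => by ext ij; simp [mul_assoc])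
      (fun a b b' => by ext ij; simp [mul_add])
      (fun c a b => by ext ij; simp [mul_left_comm]))
    1 (fun a b => by
      rw [one_mul, EuclideanSpace.norm_eq, EuclideanSpace.norm_eq, EuclideanSpace.norm_eq,
        ← Real.sqrt_mul (by positivity)]
      apply Real.sqrt_le_sqrt
      rw [Fintype.sum_prod_type, Finset.sum_mul_sum]
      simp [mul_pow])

@[simp] lemma outer_apply (a b : E2) (ij : Fin 2 × Fin 2) : outer a b ij = a ij.1 * b ij.2 := rfl

lemma norm_outer_le : ‖outer‖ ≤ 1 := LinearMap.mkContinuous₂_norm_le _ zero_le_one _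

/-- The outer product `u ⊗ w ∈ L²(O; ℝ^{2 × 2})` of two elements of `𝕍`. -/
def outerL2 (u w : V O) : L2Mat O :=
  outer.holderL (volume.restrict O) 4 4 2 (toL4 O u) (toL4 O w)

/-- The pointwise inner product `u · w ∈ L²(O)` of two elements of `𝕍`. -/
def dotL2 (u w : V O) : Lp ℝ 2 (volume.restrict O) :=
  (innerSL ℝ : E2 →L[ℝ] E2 →L[ℝ] ℝ).holderL (volume.restrict O) 4 4 2 (toL4 O u) (toL4 O w)

lemma continuous_outerL2 : Continuous fun z : V O × V O => outerL2 z.1 z.2 := by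
  unfold outerL2
  fun_prop

lemma continuous_dotL2 : Continuous fun z : V O × V O => dotL2 z.1 z.2 := by
  unfold dotL2
  fun_prop

lemma norm_outerL2_le (u w : V O) : ‖outerL2 u w‖ ≤ ‖toL4 O u‖ * ‖toL4 O w‖ := by
  refine (ContinuousLinearMap.norm_holder_apply_apply_le outer _ _).trans ?_
  have := norm_outer_le
  calc ‖outer‖ * ‖toL4 O u‖ * ‖toL4 O w‖ ≤ 1 * ‖toL4 O u‖ * ‖toL4 O w‖ := by gcongr
    _ = _ := by ring

lemma norm_dotL2_le (u w : V O) : ‖dotL2 u w‖ ≤ ‖toL4 O u‖ * ‖toL4 O w‖ := by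
  refine (ContinuousLinearMap.norm_holder_apply_apply_le (innerSL ℝ : E2 →L[ℝ] E2 →L[ℝ] ℝ)
    _ _).trans ?_
  have : ‖(innerSL ℝ : E2 →L[ℝ] E2 →L[ℝ] ℝ)‖ ≤ 1 := norm_innerSL_le ℝ
  calc ‖(innerSL ℝ : E2 →L[ℝ] E2 →L[ℝ] ℝ)‖ * ‖toL4 O u‖ * ‖toL4 O w‖
      ≤ 1 * ‖toL4 O u‖ * ‖toL4 O w‖ := by gcongr
    _ = _ := by ring

lemma coeFn_outerL2 (u w : V O) :
    outerL2 u w =ᵐ[volume.restrict O] fun x => outer (field u x) (field w x) := by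
  filter_upwards [outer.coeFn_holder (r := 2) (toL4 O u) (toL4 O w), coeFn_toL4 u, coeFn_toL4 w]
    with x h1 h2 h3
  rw [← h2, ← h3, ← h1]
  rfl

lemma coeFn_dotL2 (u w : V O) :
    dotL2 u w =ᵐ[volume.restrict O] fun x => ⟪field u x, field w x⟫ := by
  filter_upwards [(innerSL ℝ : E2 →L[ℝ] E2 →L[ℝ] ℝ).coeFn_holder (r := 2) (toL4 O u) (toL4 O w),
    coeFn_toL4 u, coeFn_toL4 w] with x h1 h2 h3
  rw [← h2, ← h3, ← innerSL_apply_apply ℝ, ← h1]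
  rfl

lemma grad_add (u v : V O) : grad (u + v) = grad u + grad v := rfl

/-- The gradient as a continuous linear map. -/
def gradL (O : Set E2) : V O →L[ℝ] L2Mat O :=
  (WithLp.sndL 2 ℝ (L2Vec O) (L2Mat O)).comp (VSub O).subtypeL

lemma continuous_grad : Continuous (grad : V O → L2Mat O) := (gradL O).continuous

lemma trilin_eq_inner (u v w : V O) : trilin u v w = ⟪outerL2 u w, grad v⟫ := by
  rw [L2.inner_def, trilin]
  refine integral_congr_ae ?_
  filter_upwards [coeFn_outerL2 u w] with x hx
  rw [hx, PiLp.inner_apply, Fintype.sum_prod_type]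
  refine Finset.sum_congr rfl fun i _ => Finset.sum_congr rfl fun j _ => ?_
  simp only [outer_apply, RCLike.inner_apply, conj_trivial]
  ring

/-- The quadrilinear form `∫_O (a · b) (c · d)`. -/
def quadForm (a b c d : V O) : ℝ := ⟪dotL2 a b, dotL2 c d⟫

lemma integrable_dot_mul_dot (a b c d : V O) :
    Integrable (fun x => ⟪field a x, field b x⟫ * ⟪field c x, field d x⟫)
      (volume.restrict O) := by
  refine (L2.integrable_inner (𝕜 := ℝ) (dotL2 a b) (dotL2 c d)).congr ?_
  filter_upwards [coeFn_dotL2 a b, coeFn_dotL2 c d] with x h1 h2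
  rw [h1, h2]
  simp only [RCLike.inner_apply, conj_trivial]
  ring

lemma quadForm_eq_integral (a b c d : V O) :
    quadForm a b c d = ∫ x in O, ⟪field a x, field b x⟫ * ⟪field c x, field d x⟫ := by
  rw [quadForm, L2.inner_def]
  refine integral_congr_ae ?_
  filter_upwards [coeFn_dotL2 a b, coeFn_dotL2 c d] with x h1 h2
  rw [h1, h2]
  simp only [RCLike.inner_apply, conj_trivial]
  ring

lemma cubicForm_eq (u v : V O) : cubicForm u v = quadForm u u u v := by
  rw [quadForm_eq_integral, cubicForm]
  refine integral_congr_ae (Eventually.of_forall fun x => ?_)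
  simp only [real_inner_smul_left, real_inner_self_eq_norm_sq]

lemma cubicDerivForm_eq (u p q : V O) :
    cubicDerivForm u p q = quadForm u u p q + 2 * quadForm u p u q := by
  rw [quadForm_eq_integral, quadForm_eq_integral, ← integral_const_mul,
    ← integral_add (integrable_dot_mul_dot _ _ _ _)
      ((integrable_dot_mul_dot _ _ _ _).const_mul 2), cubicDerivForm]
  refine integral_congr_ae (Eventually.of_forall fun x => ?_)
  simp only [inner_add_left, real_inner_smul_left, real_inner_self_eq_norm_sq]
  ring

lemma cubicRemainderForm_eq (a w p : V O) :
    cubicRemainderForm a w p = 2 * quadForm a w w p + quadForm w w w p + quadForm w w a p := by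
  rw [quadForm_eq_integral, quadForm_eq_integral, quadForm_eq_integral, ← integral_const_mul,
    ← integral_add ((integrable_dot_mul_dot _ _ _ _).const_mul 2) (integrable_dot_mul_dot _ _ _ _),
    ← integral_add ?_ (integrable_dot_mul_dot _ _ _ _), cubicRemainderForm]
  rotate_left
  · exact ((integrable_dot_mul_dot _ _ _ _).const_mul 2).add (integrable_dot_mul_dot _ _ _ _)
  refine integral_congr_ae (Eventually.of_forall fun x => ?_)
  simp only [inner_add_left, real_inner_smul_left, real_inner_self_eq_norm_sq]
  ring

lemma outerL2_add_left (u u' w : V O) : outerL2 (u + u') w = outerL2 u w + outerL2 u' w := by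
  simp only [outerL2, map_add, _root_.add_apply]

lemma dotL2_add_left (u u' w : V O) : dotL2 (u + u') w = dotL2 u w + dotL2 u' w := by
  simp only [dotL2, map_add, _root_.add_apply]

lemma dotL2_add_right (u w w' : V O) : dotL2 u (w + w') = dotL2 u w + dotL2 u w' := by
  simp only [dotL2, map_add]

lemma dotL2_comm (u w : V O) : dotL2 u w = dotL2 w u := by
  apply Lp.ext
  filter_upwards [coeFn_dotL2 u w, coeFn_dotL2 w u] with x h1 h2
  rw [h1, h2, real_inner_comm]

/-- The Taylor expansion of the convection term, which is quadratic. -/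
lemma trilin_expand (u w p : V O) :
    trilin (u + w) (u + w) p - trilin u u p =
      trilin w w p + (trilin u w p + trilin w u p) := by
  simp only [trilin_eq_inner, outerL2_add_left, grad_add, inner_add_left, inner_add_right]
  ring

/-- The Taylor expansion of the absorption term, which is cubic. -/
lemma cubicForm_expand (u w p : V O) :
    cubicForm (u + w) p - cubicForm u p =
      cubicDerivForm u p w + cubicRemainderForm u w p := by
  have h1 : quadForm u w u p = quadForm u p u w := by
    rw [quadForm, quadForm, real_inner_comm]
  have h2 : quadForm u u p w = quadForm u u w p := by
    rw [quadForm, quadForm, dotL2_comm p w]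
  have h3 : dotL2 w u = dotL2 u w := dotL2_comm w u
  rw [cubicForm_eq, cubicForm_eq, cubicDerivForm_eq, cubicRemainderForm_eq, h2, ← h1]
  simp only [quadForm, dotL2_add_left, dotL2_add_right, h3, inner_add_left, inner_add_right]
  ring

lemma abs_trilin_le (u v w : V O) : |trilin u v w| ≤ ‖toL4 O u‖ * ‖toL4 O w‖ * ‖v‖ := by
  rw [trilin_eq_inner]
  refine (abs_real_inner_le_norm _ _).trans ?_
  exact mul_le_mul (norm_outerL2_le u w) (norm_grad_le v) (norm_nonneg _) (by positivity)

lemma abs_quadForm_le (a b c d : V O) :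
    |quadForm a b c d| ≤ (‖toL4 O a‖ * ‖toL4 O b‖) * (‖toL4 O c‖ * ‖toL4 O d‖) := by
  refine (abs_real_inner_le_norm _ _).trans ?_
  exact mul_le_mul (norm_dotL2_le a b) (norm_dotL2_le c d) (norm_nonneg _) (by positivity)

lemma aestronglyMeasurable_trilin {ν : Measure ℝ} {a b c : ℝ → V O}
    (ha : AEStronglyMeasurable a ν) (hb : AEStronglyMeasurable b ν)
    (hc : AEStronglyMeasurable c ν) :
    AEStronglyMeasurable (fun t => trilin (a t) (b t) (c t)) ν := by
  simp only [trilin_eq_inner]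
  exact (continuous_outerL2.comp_aestronglyMeasurable (ha.prodMk hc)).inner
    (continuous_grad.comp_aestronglyMeasurable hb)

lemma aestronglyMeasurable_quadForm {ν : Measure ℝ} {a b c d : ℝ → V O}
    (ha : AEStronglyMeasurable a ν) (hb : AEStronglyMeasurable b ν)
    (hc : AEStronglyMeasurable c ν) (hd : AEStronglyMeasurable d ν) :
    AEStronglyMeasurable (fun t => quadForm (a t) (b t) (c t) (d t)) ν := by
  have h1 : AEStronglyMeasurable (fun t => dotL2 (a t) (b t)) ν :=
    Continuous.comp_aestronglyMeasurable (g := fun z : V O × V O => dotL2 z.1 z.2)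
      (f := fun t => (a t, b t)) continuous_dotL2 (ha.prodMk hb)
  have h2 : AEStronglyMeasurable (fun t => dotL2 (c t) (d t)) ν :=
    Continuous.comp_aestronglyMeasurable (g := fun z : V O × V O => dotL2 z.1 z.2)
      (f := fun t => (c t, d t)) continuous_dotL2 (hc.prodMk hd)
  exact h1.inner (𝕜 := ℝ) h2

/-! ### Bounds for the forms

In the bounds below, `M` bounds the `ℍ`-norm of the states and `m` their `𝕍`-norm. Along a
trajectory `M` is a constant and `m` is square integrable in time. -/

lemma norm_toL4_mul_le {M m : ℝ} {a b : V O} (haH : ‖VtoH O a‖ ≤ M) (ha : ‖a‖ ≤ m)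
    (hbH : ‖VtoH O b‖ ≤ M) (hb : ‖b‖ ≤ m) :
    ‖toL4 O a‖ * ‖toL4 O b‖ ≤ ladyzhenskayaConst * M * m := by
  have hM : 0 ≤ M := (norm_nonneg _).trans haH
  have h : ∀ v : V O, ‖VtoH O v‖ ≤ M → ‖v‖ ≤ m →
      ‖toL4 O v‖ ^ 2 ≤ ladyzhenskayaConst * M * m := by
    intro v hvH hv
    refine (norm_toL4_sq_le v).trans ?_
    rw [mul_assoc]
    gcongr
  have h1 := h a haH ha
  have h2 := h b hbH hb
  nlinarith [sq_nonneg (‖toL4 O a‖ - ‖toL4 O b‖)]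

/-- The product of the `L⁴` norms of a state and of a test function. The Ladyzhenskaya inequality
splits the `𝕍`-norm of the state evenly, which leaves a bound that is linear in `m`. -/
lemma norm_toL4_mul_test_le {M m : ℝ} {a v : V O} (haH : ‖VtoH O a‖ ≤ M) (ha : ‖a‖ ≤ m) :
    ‖toL4 O a‖ * ‖toL4 O v‖ ≤
      ladyzhenskayaConst * (1 + M) * (‖v‖ + m * ‖VtoH O v‖) := by
  have hM : 0 ≤ M := (norm_nonneg _).trans haH
  have hm : 0 ≤ m := (norm_nonneg _).trans ha
  set L : ℝ := (ladyzhenskayaConst : ℝ)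
  have hL : 0 ≤ L := NNReal.coe_nonneg _
  refine abs_le_of_sq_le_sq' ?_ (by positivity) |>.2
  calc (‖toL4 O a‖ * ‖toL4 O v‖) ^ 2 = ‖toL4 O a‖ ^ 2 * ‖toL4 O v‖ ^ 2 := by ring
    _ ≤ (L * (M * m)) * (L * (‖VtoH O v‖ * ‖v‖)) := by
        gcongr
        · exact (norm_toL4_sq_le a).trans (by gcongr)
        · exact norm_toL4_sq_le v
    _ = L ^ 2 * (M * ((m * ‖VtoH O v‖) * ‖v‖)) := by ring
    _ ≤ L ^ 2 * ((1 + M) ^ 2 * (‖v‖ + m * ‖VtoH O v‖) ^ 2) := by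
        have h0 : 0 ≤ m * ‖VtoH O v‖ := by positivity
        have h1 : 0 ≤ ‖v‖ := norm_nonneg v
        gcongr
        · nlinarith
        · nlinarith [mul_nonneg h0 h1]
    _ = _ := by ring

/-- The quantity `m ‖v‖_𝕍 + m² ‖v‖_ℍ`, which up to a constant bounds all the terms of the equations
tested with `v`. -/
def testBound (m : ℝ) (v : V O) : ℝ := m * ‖v‖ + m ^ 2 * ‖VtoH O v‖

lemma abs_trilin_test_le {M m : ℝ} {a b v : V O} (haH : ‖VtoH O a‖ ≤ M) (ha : ‖a‖ ≤ m)
    (hb : ‖b‖ ≤ m) :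
    |trilin a b v| ≤ ladyzhenskayaConst * (1 + M) * testBound m v := by
  have hM : 0 ≤ M := (norm_nonneg _).trans haH
  have hm : 0 ≤ m := (norm_nonneg _).trans ha
  calc |trilin a b v| ≤ ‖toL4 O a‖ * ‖toL4 O v‖ * ‖b‖ := abs_trilin_le _ _ _
    _ ≤ (ladyzhenskayaConst * (1 + M) * (‖v‖ + m * ‖VtoH O v‖)) * m := by
        refine mul_le_mul (norm_toL4_mul_test_le haH ha) hb (norm_nonneg _) (by positivity)
    _ = _ := by rw [testBound]; ring

lemma abs_trilin_test_left_le {M m : ℝ} {a b v : V O} (haH : ‖VtoH O a‖ ≤ M) (ha : ‖a‖ ≤ m)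
    (hb : ‖b‖ ≤ m) :
    |trilin v b a| ≤ ladyzhenskayaConst * (1 + M) * testBound m v := by
  have hM : 0 ≤ M := (norm_nonneg _).trans haH
  have hm : 0 ≤ m := (norm_nonneg _).trans ha
  calc |trilin v b a| ≤ ‖toL4 O a‖ * ‖toL4 O v‖ * ‖b‖ := by
        rw [mul_comm ‖toL4 O a‖]
        exact abs_trilin_le _ _ _
    _ ≤ (ladyzhenskayaConst * (1 + M) * (‖v‖ + m * ‖VtoH O v‖)) * m := by
        refine mul_le_mul (norm_toL4_mul_test_le haH ha) hb (norm_nonneg _) (by positivity)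
    _ = _ := by rw [testBound]; ring

lemma abs_trilin_test_mid_le {M m : ℝ} {a b v : V O} (haH : ‖VtoH O a‖ ≤ M) (ha : ‖a‖ ≤ m)
    (hbH : ‖VtoH O b‖ ≤ M) (hb : ‖b‖ ≤ m) :
    |trilin a v b| ≤ ladyzhenskayaConst * (1 + M) * testBound m v := by
  have hM : 0 ≤ M := (norm_nonneg _).trans haH
  have hm : 0 ≤ m := (norm_nonneg _).trans ha
  calc |trilin a v b| ≤ ‖toL4 O a‖ * ‖toL4 O b‖ * ‖v‖ := abs_trilin_le _ _ _
    _ ≤ (ladyzhenskayaConst * M * m) * ‖v‖ := by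
        exact mul_le_mul_of_nonneg_right (norm_toL4_mul_le haH ha hbH hb) (norm_nonneg _)
    _ = ladyzhenskayaConst * M * (m * ‖v‖) := by ring
    _ ≤ _ := by
        rw [testBound]
        gcongr
        · linarith
        · have : 0 ≤ m ^ 2 * ‖VtoH O v‖ := by positivity
          linarith

lemma abs_quadForm_test_le {M m : ℝ} {a b c v : V O} (haH : ‖VtoH O a‖ ≤ M) (ha : ‖a‖ ≤ m)
    (hbH : ‖VtoH O b‖ ≤ M) (hb : ‖b‖ ≤ m) (hcH : ‖VtoH O c‖ ≤ M) (hc : ‖c‖ ≤ m) :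
    |quadForm a b c v| ≤ (ladyzhenskayaConst * (1 + M)) ^ 2 * testBound m v := by
  have hM : 0 ≤ M := (norm_nonneg _).trans haH
  have hm : 0 ≤ m := (norm_nonneg _).trans ha
  calc |quadForm a b c v| ≤ (‖toL4 O a‖ * ‖toL4 O b‖) * (‖toL4 O c‖ * ‖toL4 O v‖) :=
        abs_quadForm_le _ _ _ _
    _ ≤ (ladyzhenskayaConst * (1 + M) * m)
          * (ladyzhenskayaConst * (1 + M) * (‖v‖ + m * ‖VtoH O v‖)) := by
        refine mul_le_mul ((norm_toL4_mul_le haH ha hbH hb).trans ?_)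
          (norm_toL4_mul_test_le hcH hc) (by positivity) (by positivity)
        gcongr
        linarith
    _ = _ := by rw [testBound]; ring

end CBF

namespace CBF

/-! ### From the weak time derivative to increments -/

/-- A smooth step from `0` to `1` on `[s, s + 1 / (n + 1)]`. -/
def smoothStep (n : ℕ) (s x : ℝ) : ℝ := Real.smoothTransition ((n + 1) * (x - s))

lemma contDiff_smoothStep (n : ℕ) (s : ℝ) : ContDiff ℝ ∞ (smoothStep n s) :=
  Real.smoothTransition.contDiff.comp (by fun_prop)

lemma smoothStep_of_le {n : ℕ} {s x : ℝ} (h : x ≤ s) : smoothStep n s x = 0 :=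
  Real.smoothTransition.zero_of_nonpos (mul_nonpos_of_nonneg_of_nonpos (by positivity)
    (by linarith))

lemma smoothStep_of_ge {n : ℕ} {s x : ℝ} (h : s + 1 / (n + 1) ≤ x) : smoothStep n s x = 1 := by
  refine Real.smoothTransition.one_of_one_le ?_
  have : (1 : ℝ) / (n + 1) ≤ x - s := by linarith
  rwa [div_le_iff₀' (by positivity)] at this

lemma monotone_smoothStep (n : ℕ) (s : ℝ) : Monotone (smoothStep n s) := fun x y h =>
  Real.smoothTransition.monotone (by gcongr)

lemma smoothStep_mem_Icc (n : ℕ) (s x : ℝ) : smoothStep n s x ∈ Icc (0 : ℝ) 1 :=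
  ⟨Real.smoothTransition.nonneg _, Real.smoothTransition.le_one _⟩

lemma tendsto_smoothStep_of_lt {s x : ℝ} (h : s < x) :
    ∀ᶠ n : ℕ in atTop, smoothStep n s x = 1 := by
  have := (tendsto_one_div_add_atTop_nhds_zero_nat (𝕜 := ℝ)).eventually
    (gt_mem_nhds (sub_pos.2 h))
  filter_upwards [this] with n hn
  exact smoothStep_of_ge (by linarith)

lemma deriv_smoothStep_nonneg (n : ℕ) (s x : ℝ) : 0 ≤ deriv (smoothStep n s) x :=
  (monotone_smoothStep n s).deriv_nonneg

lemma deriv_smoothStep_eq_zero {n : ℕ} {s x : ℝ} (h : 1 / ((n : ℝ) + 1) < |x - s|) :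
    deriv (smoothStep n s) x = 0 := by
  have hpos : (0 : ℝ) < 1 / ((n : ℝ) + 1) := by positivity
  rcases lt_abs.1 h with h | h
  · have : smoothStep n s =ᶠ[𝓝 x] fun _ => 1 := by
      filter_upwards [lt_mem_nhds (show s + 1 / (n + 1) < x by linarith)] with y hy
      exact smoothStep_of_ge hy.le
    rw [this.deriv_eq, deriv_const]
  · have : smoothStep n s =ᶠ[𝓝 x] fun _ => 0 := by
      filter_upwards [gt_mem_nhds (show x < s by linarith)] with y hy
      exact smoothStep_of_le hy.le
    rw [this.deriv_eq, deriv_const]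

variable {E : Type*} [NormedAddCommGroup E] [NormedSpace ℝ E]

lemma continuous_deriv_smoothStep (n : ℕ) (s : ℝ) : Continuous (deriv (smoothStep n s)) :=
  (contDiff_smoothStep n s).continuous_deriv (by simp)

/-- The derivatives of the smooth steps at `s` concentrate at `s`. -/
lemma tendsto_integral_deriv_smoothStep [CompleteSpace E] {T s : ℝ} {u : ℝ → E}
    (hu : ContinuousOn u (Icc 0 T)) (hs : s ∈ Ioo 0 T) :
    Tendsto (fun n : ℕ => ∫ x in 0..T, deriv (smoothStep n s) x • u x) atTop (𝓝 (u s)) := by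
  have hT : 0 ≤ T := (hs.1.trans hs.2).le
  have hint : ∀ n : ℕ, ∀ v : ℝ → E, ContinuousOn v (Icc 0 T) →
      IntervalIntegrable (fun x => deriv (smoothStep n s) x • v x) volume 0 T := fun n v hv =>
    ((continuous_deriv_smoothStep n s).continuousOn.smul
      (by rwa [uIcc_of_le hT])).intervalIntegrable
  rw [Metric.tendsto_atTop']
  intro ε hε
  obtain ⟨δ, hδ, hδ'⟩ := Metric.continuousWithinAt_iff.1 (hu s ⟨hs.1.le, hs.2.le⟩) (ε / 2)
    (by positivity)
  have hsmall := (tendsto_one_div_add_atTop_nhds_zero_nat (𝕜 := ℝ)).eventually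
    (gt_mem_nhds (lt_min hδ (sub_pos.2 hs.2)))
  obtain ⟨N, hN⟩ := eventually_atTop.1 hsmall
  refine ⟨N, fun n hn => ?_⟩
  have hn1 := (hN n hn.le).trans_le (min_le_left _ _)
  have hn2 := (hN n hn.le).trans_le (min_le_right _ _)
  have hone : ∫ x in 0..T, deriv (smoothStep n s) x = 1 := by
    rw [intervalIntegral.integral_deriv_eq_sub
      (fun x _ => (contDiff_smoothStep n s).differentiable (by simp) x)
      ((continuous_deriv_smoothStep n s).intervalIntegrable _ _),
      smoothStep_of_ge (by linarith), smoothStep_of_le hs.1.le, sub_zero]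
  have hus : u s = ∫ x in 0..T, deriv (smoothStep n s) x • u s := by
    rw [intervalIntegral.integral_smul_const, hone, one_smul]
  rw [dist_eq_norm]
  conv_lhs => rw [hus]
  rw [← intervalIntegral.integral_sub (hint n u hu) (hint n _ continuousOn_const)]
  refine lt_of_le_of_lt (intervalIntegral.norm_integral_le_of_norm_le hT
    (g := fun x => deriv (smoothStep n s) x * (ε / 2)) ?_
    (((continuous_deriv_smoothStep n s).mul continuous_const).intervalIntegrable _ _)) ?_
  · refine Eventually.of_forall fun x hx => ?_
    rw [← smul_sub, norm_smul, Real.norm_of_nonneg (deriv_smoothStep_nonneg n s x)]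
    by_cases hx' : |x - s| ≤ 1 / ((n : ℝ) + 1)
    · gcongr
      · exact deriv_smoothStep_nonneg n s x
      · rw [← dist_eq_norm]
        exact (hδ' ⟨hx.1.le, hx.2⟩ (by rw [Real.dist_eq]; linarith)).le
    · rw [deriv_smoothStep_eq_zero (not_le.1 hx'), zero_mul, zero_mul]
  · rw [intervalIntegral.integral_mul_const, hone]
    linarith

/-- A continuous function with integrable weak derivative `g` has increments `∫ g`. The test
functions are smooth approximations of the indicator function of `(s, t]`. -/
theorem sub_eq_integral_of_weakDeriv [CompleteSpace E] {T : ℝ} (hT : 0 < T) {u g : ℝ → E}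
    (hu : ContinuousOn u (Icc 0 T)) (hg : IntegrableOn g (Ioc 0 T))
    (h : ∀ φ : ℝ → ℝ, ContDiff ℝ ∞ φ → HasCompactSupport φ → tsupport φ ⊆ Ioo 0 T →
      ∫ t in 0..T, deriv φ t • u t = -∫ t in 0..T, φ t • g t)
    {s t : ℝ} (hs : s ∈ Icc 0 T) (ht : t ∈ Icc 0 T) : u t - u s = ∫ r in s..t, g r := by
  have hgi : IntervalIntegrable g volume 0 T :=
    (intervalIntegrable_iff_integrableOn_Ioc_of_le hT.le).2 hg
  have hsub : ∀ {a b : ℝ}, a ∈ Icc 0 T → b ∈ Icc 0 T → IntervalIntegrable g volume a b :=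
    fun ha hb => hgi.mono_set (by
      rw [uIcc_of_le hT.le]
      exact uIcc_subset_Icc ha hb)
  have key : ∀ a b : ℝ, a ∈ Ioo 0 T → b ∈ Ioo 0 T → a < b → u b - u a = ∫ r in a..b, g r := by
    intro a b ha hb hab
    set φ : ℕ → ℝ → ℝ := fun n x => smoothStep n a x - smoothStep n b x with hφ
    have hφs : ∀ n, ContDiff ℝ ∞ (φ n) := fun n =>
      (contDiff_smoothStep n a).sub (contDiff_smoothStep n b)
    have hφd : ∀ n x, deriv (φ n) x = deriv (smoothStep n a) x - deriv (smoothStep n b) x :=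
      fun n x => deriv_fun_sub ((contDiff_smoothStep n a).differentiable (by simp) x)
        ((contDiff_smoothStep n b).differentiable (by simp) x)
    have hφt : ∀ n, tsupport (φ n) ⊆ Icc a (b + 1 / (n + 1)) := by
      intro n
      refine closure_minimal (fun x hx => ?_) isClosed_Icc
      by_contra hx'
      rw [mem_Icc, not_and_or, not_le, not_le] at hx'
      apply hx
      rcases hx' with hx' | hx'
      · simp only [hφ]
        rw [smoothStep_of_le hx'.le, smoothStep_of_le (hx'.trans hab).le, sub_zero]
      · simp only [hφ]
        rw [smoothStep_of_ge hx'.le, smoothStep_of_ge (by linarith), sub_self]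
    have hweak : ∀ᶠ n : ℕ in atTop,
        (∫ x in 0..T, deriv (smoothStep n a) x • u x)
          - (∫ x in 0..T, deriv (smoothStep n b) x • u x) = -∫ x in 0..T, φ n x • g x := by
      have hsmall := (tendsto_one_div_add_atTop_nhds_zero_nat (𝕜 := ℝ)).eventually
        (gt_mem_nhds (sub_pos.2 hb.2))
      filter_upwards [hsmall] with n hn
      rw [← h (φ n) (hφs n) (HasCompactSupport.intro isCompact_Icc fun x hx =>
          image_eq_zero_of_notMem_tsupport fun hx' => hx (hφt n hx'))
        ((hφt n).trans (Icc_subset_Ioo ha.1 (by linarith))), ← intervalIntegral.integral_sub]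
      · exact intervalIntegral.integral_congr fun x _ => by simp only [hφd, sub_smul]
      all_goals
        exact ((continuous_deriv_smoothStep n _).continuousOn.smul
          (by rwa [uIcc_of_le hT.le])).intervalIntegrable
    have hlim1 := (tendsto_integral_deriv_smoothStep hu ha).sub
      (tendsto_integral_deriv_smoothStep hu hb)
    have hlim2 : Tendsto (fun n => ∫ x in 0..T, φ n x • g x) atTop
        (𝓝 (∫ x in 0..T, (Ioc a b).indicator g x)) := by
      refine intervalIntegral.tendsto_integral_filter_of_dominated_convergence (fun x => ‖g x‖)
        ?_ ?_ hgi.norm ?_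
      · refine Eventually.of_forall fun n => ?_
        exact (hφs n).continuous.aestronglyMeasurable.smul hgi.def'.aestronglyMeasurable
      · refine Eventually.of_forall fun n => Eventually.of_forall fun x _ => ?_
        rw [norm_smul]
        refine mul_le_of_le_one_left (norm_nonneg _) ?_
        have h1 := smoothStep_mem_Icc n a x
        have h2 := smoothStep_mem_Icc n b x
        rw [Real.norm_eq_abs, abs_le]
        exact ⟨by linarith [h1.1, h2.2], by linarith [h1.2, h2.1]⟩
      · refine Eventually.of_forall fun x _ => ?_
        refine tendsto_const_nhds.congr' ?_
        by_cases hxa : x ≤ a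
        · refine Eventually.of_forall fun n => ?_
          simp only [hφ]
          rw [smoothStep_of_le hxa, smoothStep_of_le (hxa.trans hab.le), sub_zero, zero_smul,
            indicator_of_notMem (fun hx => not_lt.2 hxa hx.1)]
        · rw [not_le] at hxa
          by_cases hxb : x ≤ b
          · filter_upwards [tendsto_smoothStep_of_lt hxa] with n hn
            simp only [hφ]
            rw [hn, smoothStep_of_le hxb, sub_zero, one_smul,
              indicator_of_mem (show x ∈ Ioc a b from ⟨hxa, hxb⟩)]
          · filter_upwards [tendsto_smoothStep_of_lt hxa,
              tendsto_smoothStep_of_lt (not_le.1 hxb)] with n hn hn'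
            simp only [hφ]
            rw [hn, hn', sub_self, zero_smul, indicator_of_notMem (fun hx => hxb hx.2)]
    have heq := tendsto_nhds_unique (hlim1.congr' hweak) hlim2.neg
    have hind : ∫ x in 0..T, (Ioc a b).indicator g x = ∫ r in a..b, g r := by
      rw [intervalIntegral.integral_of_le hT.le, intervalIntegral.integral_of_le hab.le,
        setIntegral_indicator measurableSet_Ioc,
        inter_eq_right.2 (Ioc_subset_Ioc ha.1.le hb.2.le)]
    rw [hind] at heq
    rw [← neg_sub, heq, neg_neg]
  -- The function `u - ∫ g` is constant inside, hence by continuity up to the endpoints.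
  set F : ℝ → E := fun r => u r - ∫ x in 0..r, g x with hF
  have hFc : ContinuousOn F (Icc 0 T) := by
    refine hu.sub ?_
    have := intervalIntegral.continuousOn_primitive_interval (μ := volume) (f := g) (a := 0)
      (b := T) (by rwa [uIcc_of_le hT.le, integrableOn_Icc_iff_integrableOn_Ioc])
    rwa [uIcc_of_le hT.le] at this
  have h0 : (0 : ℝ) ∈ Icc 0 T := ⟨le_rfl, hT.le⟩
  have hstep : ∀ a b : ℝ, a ∈ Ioo 0 T → b ∈ Ioo 0 T → a < b → F b = F a := by
    intro a b ha hb hab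
    have ha' := Ioo_subset_Icc_self ha
    have hb' := Ioo_subset_Icc_self hb
    have h1 := key a b ha hb hab
    rw [← intervalIntegral.integral_interval_sub_left (hsub h0 hb') (hsub h0 ha')] at h1
    simp only [hF]
    rw [sub_eq_sub_iff_add_eq_add] at h1 ⊢
    rw [h1, add_comm]
  have hmid : T / 2 ∈ Ioo 0 T := ⟨by linarith, by linarith⟩
  have hconst : EqOn F (fun _ => F (T / 2)) (Icc 0 T) := by
    refine EqOn.of_subset_closure (s := Ioo 0 T) (fun r hr => ?_) hFc continuousOn_const
      Ioo_subset_Icc_self (closure_Ioo hT.ne).ge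
    rcases lt_trichotomy r (T / 2) with hlt | heq | hlt
    · exact (hstep _ _ hr hmid hlt).symm
    · rw [heq]
    · exact hstep _ _ hmid hr hlt
  have h1 : F t = F s := (hconst ht).trans (hconst hs).symm
  simp only [hF] at h1
  rw [← intervalIntegral.integral_interval_sub_left (hsub h0 ht) (hsub h0 hs)]
  rw [sub_eq_sub_iff_add_eq_add] at h1 ⊢
  rw [h1, add_comm]

end CBF

namespace CBF

/-! ### Integration by parts in time -/

/-- Translations act continuously on `L²(ℝ; X)`. -/
lemma exists_integral_translate_sub_sq_le {X : Type*} [NormedAddCommGroup X] {Z : ℝ → X}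
    (hZ : MemLp Z 2 volume) {ε : ℝ} (hε : 0 < ε) : ∃ δ > 0, ∀ a b : ℝ, |b - a| < δ →
      ∫ t, ‖Z (t + b) - Z (t + a)‖ ^ 2 ≤ ε := by
  have : Fact ((2 : ℝ≥0∞) ≠ ⊤) := ⟨by simp⟩
  have hcont : Continuous fun c : ℝ => DomAddAct.mk c +ᵥ hZ.toLp Z :=
    (DomAddAct.continuous_mk.vadd continuous_const)
  obtain ⟨δ, hδ, h⟩ := Metric.continuous_iff.1 hcont 0 (Real.sqrt ε) (by positivity)
  refine ⟨δ, hδ, fun a b hab => ?_⟩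
  have hc := h (b - a) (by simpa [Real.dist_eq] using hab)
  rw [DomAddAct.mk_vadd_toLp, DomAddAct.mk_vadd_toLp, dist_eq_norm, ← MemLp.toLp_sub] at hc
  set c := b - a
  have hm : MemLp (fun t => Z (c + t) - Z t) 2 volume :=
    (hZ.comp_measurePreserving (measurePreserving_add_left volume c)).sub hZ
  have hc' : ‖hm.toLp _‖ < Real.sqrt ε := by
    refine lt_of_eq_of_lt ?_ hc
    congr 1
    apply MemLp.toLp_congr
    exact Eventually.of_forall fun t => by simp
  have hsq : ∫ t, ‖Z (c + t) - Z t‖ ^ 2 = ‖hm.toLp _‖ ^ 2 := by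
    rw [Lp.norm_toLp, hm.eLpNorm_eq_integral_rpow_norm (by simp) (by simp),
      ENNReal.toReal_ofReal (by positivity)]
    simp only [ENNReal.toReal_ofNat, Real.rpow_ofNat]
    rw [← one_div, ← Real.sqrt_eq_rpow, Real.sq_sqrt (by positivity)]
  calc ∫ t, ‖Z (t + b) - Z (t + a)‖ ^ 2 = ∫ t, ‖Z (c + (t + a)) - Z (t + a)‖ ^ 2 := by
        congr 1 with t
        congr 4
        simp only [c]
        ring
    _ = ∫ t, ‖Z (c + t) - Z t‖ ^ 2 :=
        integral_add_right_eq_self (fun t => ‖Z (c + t) - Z t‖ ^ 2) a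
    _ ≤ ε := by
        rw [hsq, ← Real.sq_sqrt hε.le]
        gcongr

variable {X Y : Type*} [NormedAddCommGroup X] [NormedSpace ℝ X]
  [NormedAddCommGroup Y] [InnerProductSpace ℝ Y]

/-- `(zX, z)` is a trajectory of class `C([0, T]; Y) ∩ L²(0, T; X)`, where `i : X → Y` is the
embedding. -/
structure IsTrajectory (i : X →L[ℝ] Y) (T : ℝ) (zX : ℝ → X) (z : ℝ → Y) : Prop where
  continuousOn : ContinuousOn z (Icc 0 T)
  memLp : MemLp zX 2 (volume.restrict (Ioc 0 T))
  ae_eq : ∀ᵐ t ∂volume.restrict (Ioc 0 T), i (zX t) = z t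

/-- `g` is an integrable family of functionals on `X` such that
`|g t v| ≤ K (m t ‖v‖_X + (m t)² ‖v‖_Y)` for a square integrable `m`. This is the form that
membership of `L²(0, T; X') + L¹(0, T; Y)` takes in the estimates; it makes the pairing with a
trajectory integrable. -/
structure HasTestBound (i : X →L[ℝ] Y) (T : ℝ) (g : ℝ → StrongDual ℝ X) : Prop where
  integrableOn : IntegrableOn g (Ioc 0 T)
  exists_bound : ∃ (m : ℝ → ℝ) (K : ℝ), (∀ t, 0 ≤ m t) ∧ 0 ≤ K ∧
    MemLp m 2 (volume.restrict (Ioc 0 T)) ∧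
    ∀ᵐ t ∂volume.restrict (Ioc 0 T), ∀ v, |g t v| ≤ K * (m t * ‖v‖ + m t ^ 2 * ‖i v‖)

variable {i : X →L[ℝ] Y} {T : ℝ}

lemma aestronglyMeasurable_clm_apply {α : Type*} [MeasurableSpace α] {ν : Measure α}
    {g : α → StrongDual ℝ X} {z : α → X}
    (hg : AEStronglyMeasurable g ν) (hz : AEStronglyMeasurable z ν) :
    AEStronglyMeasurable (fun t => g t (z t)) ν :=
  Continuous.comp_aestronglyMeasurable (g := fun q : StrongDual ℝ X × X => q.1 q.2)
    (f := fun t => (g t, z t)) (by fun_prop) (hg.prodMk hz)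

lemma HasTestBound.integrableOn_apply {g : ℝ → StrongDual ℝ X} {zX : ℝ → X} {z : ℝ → Y}
    (hg : HasTestBound i T g) (hz : IsTrajectory i T zX z) :
    IntegrableOn (fun t => g t (zX t)) (Ioc 0 T) := by
  obtain ⟨m, K, hm0, hK, hm, hb⟩ := hg.exists_bound
  obtain ⟨C, hC⟩ := isCompact_Icc.exists_bound_of_continuousOn hz.continuousOn
  have h1 : Integrable (fun t => K * (m t ^ 2 + ‖zX t‖ ^ 2 + m t ^ 2 * C))
      (volume.restrict (Ioc 0 T)) :=
    ((hm.integrable_sq.add ((memLp_two_iff_integrable_sq_norm hz.memLp.1).1 hz.memLp)).add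
      (hm.integrable_sq.mul_const C)).const_mul K
  refine h1.mono' (aestronglyMeasurable_clm_apply hg.integrableOn.aestronglyMeasurable
    hz.memLp.1) ?_
  filter_upwards [hb, hz.ae_eq, ae_restrict_mem measurableSet_Ioc] with t h1 h2 h3
  refine (h1 (zX t)).trans ?_
  rw [h2]
  have h4 := hC t (Ioc_subset_Icc_self h3)
  have h5 := mul_le_mul_of_nonneg_left h4 (sq_nonneg (m t))
  gcongr
  nlinarith [sq_nonneg (m t - ‖zX t‖), norm_nonneg (zX t), hm0 t]

lemma aestronglyMeasurable_comp_add {F : Type*} [TopologicalSpace F] {u : ℝ → F} {h c : ℝ}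
    (hu : AEStronglyMeasurable u (volume.restrict (Ioc 0 T))) (hc : c ∈ Icc 0 h) :
    AEStronglyMeasurable (fun t => u (t + c)) (volume.restrict (Ioc 0 (T - h))) := by
  have hmp := ((measurePreserving_add_right volume c).restrict_preimage
    (measurableSet_Ioc (a := (0 : ℝ)) (b := T)))
  refine (hu.comp_measurePreserving hmp).mono_measure (Measure.restrict_mono (fun t ht => ?_) le_rfl)
  exact ⟨by linarith [ht.1, hc.1], by linarith [ht.2, hc.2]⟩

/-- Shifting the two factors of the pairing `∫ ⟨g, z⟩` by at most `h` changes it by little. -/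
lemma HasTestBound.exists_shift_le {g : ℝ → StrongDual ℝ X} {zX : ℝ → X} {z : ℝ → Y}
    (hg : HasTestBound i T g) (hz : IsTrajectory i T zX z) (hT : 0 < T) {ε : ℝ} (hε : 0 < ε) :
    ∃ h₀ > 0, ∀ h, 0 < h → h < h₀ → h < T → ∀ a ∈ Icc 0 h, ∀ b ∈ Icc 0 h,
      |(∫ t in 0..(T - h), g (t + a) (zX (t + b))) - ∫ t in 0..T, g t (zX t)| ≤ ε := by
  obtain ⟨m, K, hm0, hK, hm, hb⟩ := hg.exists_bound
  have hint := hg.integrableOn_apply hz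
  set Z : ℝ → X := (Ioc 0 T).indicator zX with hZdef
  set m' : ℝ → ℝ := (Ioc 0 T).indicator m with hmdef
  have hZ : MemLp Z 2 volume := (memLp_indicator_iff_restrict measurableSet_Ioc).2 hz.memLp
  have hm' : MemLp m' 2 volume := (memLp_indicator_iff_restrict measurableSet_Ioc).2 hm
  set A : ℝ := ∫ t, m' t ^ 2 with hA
  have hA0 : 0 ≤ A := integral_nonneg fun t => sq_nonneg _
  set η : ℝ := ε / (2 * (K + 1) * (2 * A + 1)) with hη
  have hη0 : 0 < η := by positivity
  obtain ⟨δ₁, hδ₁, htrans⟩ := exists_integral_translate_sub_sq_le hZ (sq_pos_of_pos hη0)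
  obtain ⟨δ₂, hδ₂, hunif⟩ := Metric.uniformContinuousOn_iff.1
    (isCompact_Icc.uniformContinuousOn_of_continuous hz.continuousOn) η hη0
  set P : ℝ → ℝ := fun r => ∫ t in 0..r, g t (zX t) with hP
  have hPc : ContinuousOn P (Icc 0 T) := by
    have := intervalIntegral.continuousOn_primitive_interval (μ := volume)
      (f := fun t => g t (zX t)) (a := 0) (b := T)
      (by rwa [uIcc_of_le hT.le, integrableOn_Icc_iff_integrableOn_Ioc])
    rwa [uIcc_of_le hT.le] at this
  obtain ⟨δ₃, hδ₃, hPu⟩ := Metric.uniformContinuousOn_iff.1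
    (isCompact_Icc.uniformContinuousOn_of_continuous hPc) (ε / 4) (by positivity)
  have hii : ∀ {r s : ℝ}, r ∈ Icc 0 T → s ∈ Icc 0 T →
      IntervalIntegrable (fun t => g t (zX t)) volume r s := fun hr hs =>
    ((intervalIntegrable_iff_integrableOn_Ioc_of_le hT.le).2 hint).mono_set (by
      rw [uIcc_of_le hT.le]
      exact uIcc_subset_Icc hr hs)
  refine ⟨min δ₁ (min δ₂ δ₃), lt_min hδ₁ (lt_min hδ₂ hδ₃), fun h h0 hlt hhT a ha b hb' => ?_⟩
  have hl1 : h < δ₁ := hlt.trans_le (min_le_left _ _)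
  have hl2 : h < δ₂ := hlt.trans_le ((min_le_right _ _).trans (min_le_left _ _))
  have hl3 : h < δ₃ := hlt.trans_le ((min_le_right _ _).trans (min_le_right _ _))
  have hTh : 0 ≤ T - h := by linarith
  have hab : |b - a| ≤ h := by
    rw [abs_le]
    exact ⟨by linarith [ha.2, hb'.1], by linarith [ha.1, hb'.2]⟩
  have hmem : ∀ c ∈ Icc 0 h, ∀ t ∈ Ioc 0 (T - h), t + c ∈ Ioc 0 T := fun c hc t ht =>
    ⟨by linarith [ht.1, hc.1], by linarith [ht.2, hc.2]⟩
  -- The same shift in both factors: only the domain of integration moves.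
  have hsame : ∫ t in 0..(T - h), g (t + a) (zX (t + a)) = P (T - h + a) - P a := by
    rw [intervalIntegral.integral_comp_add_right (fun t => g t (zX t)) a, zero_add]
    simp only [hP]
    rw [intervalIntegral.integral_interval_sub_left]
    · exact hii ⟨le_rfl, hT.le⟩ ⟨by linarith [ha.1], by linarith [ha.2]⟩
    · exact hii ⟨le_rfl, hT.le⟩ ⟨ha.1, by linarith [ha.2]⟩
  have hsame_le : |(∫ t in 0..(T - h), g (t + a) (zX (t + a))) - ∫ t in 0..T, g t (zX t)|
      ≤ ε / 2 := by
    rw [hsame]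
    have e1 := hPu (T - h + a) ⟨by linarith [ha.1], by linarith [ha.2]⟩ T ⟨hT.le, le_rfl⟩ (by
      rw [Real.dist_eq, abs_lt]
      exact ⟨by linarith [ha.1], by linarith [ha.2]⟩)
    have e2 := hPu a ⟨ha.1, by linarith [ha.2]⟩ 0 ⟨le_rfl, hT.le⟩ (by
      rw [Real.dist_eq, abs_lt]
      exact ⟨by linarith [ha.1], by linarith [ha.2]⟩)
    have e3 : P 0 = 0 := by simp [hP]
    rw [Real.dist_eq] at e1 e2
    rw [e3] at e2
    change |P (T - h + a) - P a - P T| ≤ ε / 2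
    rw [abs_lt] at e1 e2
    rw [abs_le]
    exact ⟨by linarith, by linarith⟩
  -- The relative shift is small in `L²(X)` and uniformly small in `Y`.
  set B : ℝ → ℝ := fun t =>
    K * (2 * η * m' (t + a) ^ 2 + η⁻¹ * ‖Z (t + b) - Z (t + a)‖ ^ 2) with hB
  have hm2 : Integrable (fun t => m' (t + a) ^ 2) :=
    (hm'.integrable_sq).comp_add_right a
  have hZ2 : Integrable (fun t => ‖Z (t + b) - Z (t + a)‖ ^ 2) := by
    have : MemLp (fun t => Z (t + b) - Z (t + a)) 2 volume :=
      (hZ.comp_measurePreserving (measurePreserving_add_right volume b)).sub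
        (hZ.comp_measurePreserving (measurePreserving_add_right volume a))
    exact (memLp_two_iff_integrable_sq_norm this.1).1 this
  have hBi : Integrable B := ((hm2.const_mul _).add (hZ2.const_mul _)).const_mul K
  have hB0 : ∀ t, 0 ≤ B t := fun t => by positivity
  have hshift : ∀ c ∈ Icc 0 h, ∀ {p : ℝ → Prop}, (∀ᵐ t ∂volume.restrict (Ioc 0 T), p t) →
      ∀ᵐ t ∂volume.restrict (Ioc 0 (T - h)), p (t + c) := by
    intro c hc p hp
    rw [ae_restrict_iff' measurableSet_Ioc] at hp ⊢
    filter_upwards [(measurePreserving_add_right volume c).quasiMeasurePreserving.ae hp]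
      with t ht ht'
    exact ht (hmem c hc t ht')
  have hpt : ∀ᵐ t ∂volume.restrict (Ioc 0 (T - h)),
      ‖g (t + a) (zX (t + b) - zX (t + a))‖ ≤ B t := by
    filter_upwards [hshift a ha hb, hshift a ha hz.ae_eq, hshift b hb' hz.ae_eq,
      ae_restrict_mem measurableSet_Ioc] with t h1 h2 h3 h4
    have k1 := hmem a ha t h4
    have k2 := hmem b hb' t h4
    have k3 : dist (z (t + b)) (z (t + a)) < η :=
      hunif _ (Ioc_subset_Icc_self k2) _ (Ioc_subset_Icc_self k1) (by
        rw [Real.dist_eq, add_sub_add_left_eq_sub]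
        linarith)
    rw [dist_eq_norm] at k3
    refine (h1 _).trans ?_
    simp only [hB, hmdef, hZdef, indicator_of_mem k1, indicator_of_mem k2]
    rw [map_sub, h2, h3]
    refine mul_le_mul_of_nonneg_left ?_ hK
    set x := m (t + a)
    set y := ‖zX (t + b) - zX (t + a)‖
    have e1 : x ^ 2 * ‖z (t + b) - z (t + a)‖ ≤ x ^ 2 * η := by gcongr
    have e2 : x * y ≤ η * x ^ 2 + η⁻¹ * y ^ 2 := by
      have : 0 ≤ η⁻¹ * ((η * x - y) ^ 2 + (η * x) * y) := by
        have hx : 0 ≤ x := hm0 _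
        have hy : 0 ≤ y := norm_nonneg _
        positivity
      have e3 : η⁻¹ * ((η * x - y) ^ 2 + (η * x) * y) = η * x ^ 2 + η⁻¹ * y ^ 2 - x * y := by
        field_simp
        ring
      linarith
    linarith
  have hdi : IntervalIntegrable (fun t => g (t + a) (zX (t + b) - zX (t + a))) volume
      0 (T - h) := by
    rw [intervalIntegrable_iff_integrableOn_Ioc_of_le hTh]
    exact hBi.integrableOn.mono'
      (aestronglyMeasurable_clm_apply
        (aestronglyMeasurable_comp_add hg.integrableOn.aestronglyMeasurable ha)
        ((aestronglyMeasurable_comp_add hz.memLp.1 hb').sub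
          (aestronglyMeasurable_comp_add hz.memLp.1 ha))) hpt
  have hsi : IntervalIntegrable (fun t => g (t + a) (zX (t + a))) volume 0 (T - h) := by
    have := (hii (r := a) (s := T - h + a) ⟨ha.1, by linarith [ha.2]⟩
      ⟨by linarith [ha.1], by linarith [ha.2]⟩).comp_add_right a
    simpa using this
  have hdiff_le : |∫ t in 0..(T - h), g (t + a) (zX (t + b) - zX (t + a))| ≤ ε / 2 := by
    rw [intervalIntegral.integral_of_le hTh, ← Real.norm_eq_abs]
    calc ‖∫ t in Ioc 0 (T - h), g (t + a) (zX (t + b) - zX (t + a))‖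
        ≤ ∫ t in Ioc 0 (T - h), B t := norm_integral_le_of_norm_le hBi.integrableOn hpt
      _ ≤ ∫ t, B t := setIntegral_le_integral hBi (Eventually.of_forall hB0)
      _ = K * (2 * η * A + η⁻¹ * ∫ t, ‖Z (t + b) - Z (t + a)‖ ^ 2) := by
          simp only [hB]
          rw [integral_const_mul, integral_add (hm2.const_mul _) (hZ2.const_mul _),
            integral_const_mul, integral_const_mul,
            integral_add_right_eq_self (fun t => m' t ^ 2) a]
      _ ≤ K * (2 * η * A + η⁻¹ * η ^ 2) := by
          gcongr
          exact htrans a b (by linarith)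
      _ = (η * (2 * A + 1)) * K := by
          field_simp
      _ ≤ (η * (2 * A + 1)) * (K + 1) := by
          gcongr
          linarith
      _ = ε / 2 := by
          rw [hη]
          field_simp
  have hsplit : ∫ t in 0..(T - h), g (t + a) (zX (t + b)) =
      (∫ t in 0..(T - h), g (t + a) (zX (t + b) - zX (t + a)))
        + ∫ t in 0..(T - h), g (t + a) (zX (t + a)) := by
    rw [← intervalIntegral.integral_add hdi hsi]
    exact intervalIntegral.integral_congr fun t _ => by simp only [map_sub]; ring
  rw [hsplit]
  rw [abs_le] at hsame_le hdiff_le ⊢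
  exact ⟨by linarith, by linarith⟩

end CBF

namespace CBF

variable {X Y : Type*} [NormedAddCommGroup X] [NormedSpace ℝ X]
  [NormedAddCommGroup Y] [InnerProductSpace ℝ Y] {i : X →L[ℝ] Y} {T : ℝ}

/-- The double integral of `B (g (t + σ)) (z (t + b))` over `t ∈ (0, T - h]`, `σ ∈ (0, h]`
exists, although `g` and `z` are only integrable: integrate in `σ` before `t`. -/
lemma integrable_shift_prod {E : Type*} [NormedAddCommGroup E] [NormedSpace ℝ E]
    (B : E →L[ℝ] X →L[ℝ] ℝ) {g : ℝ → E} {zX : ℝ → X}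
    (hg : IntegrableOn g (Ioc 0 T)) (hz : IntegrableOn zX (Ioc 0 T)) {h b : ℝ}
    (hb : b ∈ Icc 0 h) :
    Integrable (fun q : ℝ × ℝ => B (g (q.1 + q.2)) (zX (q.1 + b)))
      ((volume.restrict (Ioc 0 (T - h))).prod (volume.restrict (Ioc 0 h))) := by
  have hG : Integrable ((Ioc 0 T).indicator g) volume :=
    (integrable_indicator_iff measurableSet_Ioc).2 hg
  have hZ : Integrable (fun t => (Ioc 0 T).indicator zX (t + b)) volume :=
    ((integrable_indicator_iff measurableSet_Ioc).2 hz).comp_add_right b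
  set G := (Ioc 0 T).indicator g
  set Z := fun t => (Ioc 0 T).indicator zX (t + b)
  have h1 : Integrable (fun q : ℝ × ℝ => B (G q.2) (Z q.1)) (volume.prod volume) := by
    refine ((hZ.norm.mul_prod hG.norm).const_mul ‖B‖).mono'
      (B.aestronglyMeasurable_comp₂ hG.aestronglyMeasurable.comp_snd
        hZ.aestronglyMeasurable.comp_fst) (Eventually.of_forall fun q => ?_)
    rw [mul_comm ‖Z q.1‖, ← mul_assoc]
    exact B.le_opNorm₂ _ _
  have h2 : Integrable (fun q : ℝ × ℝ => B (G (q.1 + q.2)) (Z q.1)) (volume.prod volume) :=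
    (measurePreserving_prod_add volume volume).integrable_comp_of_integrable h1
  rw [Measure.prod_restrict]
  refine (h2.integrableOn (s := Ioc 0 (T - h) ×ˢ Ioc 0 h)).congr ?_
  filter_upwards [ae_restrict_mem (measurableSet_Ioc.prod measurableSet_Ioc)] with q hq
  have e1 : q.1 + q.2 ∈ Ioc 0 T := ⟨by linarith [hq.1.1, hq.2.1], by linarith [hq.1.2, hq.2.2]⟩
  have e2 : q.1 + b ∈ Ioc 0 T := ⟨by linarith [hq.1.1, hb.1], by linarith [hq.1.2, hb.2]⟩
  simp only [G, Z, indicator_of_mem e1, indicator_of_mem e2]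

lemma HasTestBound.intervalIntegrable {g : ℝ → StrongDual ℝ X} (hg : HasTestBound i T g)
    (hT : 0 < T) {r s : ℝ} (hr : r ∈ Icc 0 T) (hs : s ∈ Icc 0 T) :
    IntervalIntegrable g volume r s :=
  ((intervalIntegrable_iff_integrableOn_Ioc_of_le hT.le).2 hg.integrableOn).mono_set (by
    rw [uIcc_of_le hT.le]
    exact uIcc_subset_Icc hr hs)

/-- The difference quotients of `w`, tested with `z`, converge to the pairing of `z` with the
derivative `g` of `w`. The test function is taken at either end of the increment: `c = 0` or
`c = 1`. -/
lemma HasTestBound.tendsto_difference_quotient {g : ℝ → StrongDual ℝ X} {zX : ℝ → X}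
    {w z : ℝ → Y} (hg : HasTestBound i T g) (hz : IsTrajectory i T zX z) (hT : 0 < T)
    (hw : ∀ r ∈ Icc 0 T, ∀ s ∈ Icc 0 T, ∀ v, ⟪w s - w r, i v⟫ = (∫ t in r..s, g t) v)
    {c : ℝ} (hc : c ∈ Icc (0 : ℝ) 1) :
    Tendsto (fun h => h⁻¹ * ∫ t in 0..(T - h), ⟪w (t + h) - w t, z (t + c * h)⟫)
      (𝓝[>] 0) (𝓝 (∫ t in 0..T, g t (zX t))) := by
  rw [Metric.tendsto_nhdsWithin_nhds]
  intro ε hε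
  obtain ⟨h₀, hh₀, hshift⟩ := hg.exists_shift_le hz hT (half_pos hε)
  refine ⟨min h₀ T, lt_min hh₀ hT, fun {h} (h0 : 0 < h) hd => ?_⟩
  rw [Real.dist_eq, sub_zero, abs_of_pos h0] at hd
  have hlt : h < h₀ := hd.trans_le (min_le_left _ _)
  have hhT : h < T := hd.trans_le (min_le_right _ _)
  have hTh : 0 ≤ T - h := by linarith
  set b := c * h with hb
  have hbm : b ∈ Icc 0 h := ⟨mul_nonneg hc.1 h0.le, mul_le_of_le_one_left h0.le hc.2⟩
  set I₀ := ∫ t in 0..T, g t (zX t)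
  have hzI : IntegrableOn zX (Ioc 0 T) := hz.memLp.integrable (by norm_num)
  have hprod : Integrable (fun q : ℝ × ℝ => g (q.1 + q.2) (zX (q.1 + b)))
      ((volume.restrict (Ioc 0 (T - h))).prod (volume.restrict (Ioc 0 h))) :=
    integrable_shift_prod (ContinuousLinearMap.id ℝ (StrongDual ℝ X)) hg.integrableOn hzI hbm
  have hpt : ∀ᵐ t ∂volume.restrict (Ioc 0 (T - h)), ⟪w (t + h) - w t, z (t + b)⟫ =
      ∫ σ in Ioc 0 h, g (t + σ) (zX (t + b)) := by
    have hae : ∀ᵐ t ∂volume.restrict (Ioc 0 (T - h)), i (zX (t + b)) = z (t + b) := by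
      have := hz.ae_eq
      rw [ae_restrict_iff' measurableSet_Ioc] at this ⊢
      filter_upwards [(measurePreserving_add_right volume b).quasiMeasurePreserving.ae this]
        with t ht ht'
      exact ht ⟨by linarith [ht'.1, hbm.1], by linarith [ht'.2, hbm.2]⟩
    filter_upwards [hae, ae_restrict_mem measurableSet_Ioc] with t ht ht'
    have e1 : t ∈ Icc 0 T := ⟨ht'.1.le, by linarith [ht'.2]⟩
    have e2 : t + h ∈ Icc 0 T := ⟨by linarith [ht'.1], by linarith [ht'.2]⟩
    rw [← ht, hw t e1 (t + h) e2, ContinuousLinearMap.intervalIntegral_apply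
      (hg.intervalIntegrable hT e1 e2), ← intervalIntegral.integral_of_le h0.le,
      intervalIntegral.integral_comp_add_left (fun s => g s (zX (t + b))) t, add_zero]
  have hswap : ∫ t in 0..(T - h), ⟪w (t + h) - w t, z (t + b)⟫ =
      ∫ σ in Ioc 0 h, ∫ t in Ioc 0 (T - h), g (t + σ) (zX (t + b)) := by
    rw [intervalIntegral.integral_of_le hTh, integral_congr_ae hpt]
    exact integral_integral_swap hprod
  have hI : IntervalIntegrable (fun σ => ∫ t in Ioc 0 (T - h), g (t + σ) (zX (t + b)))
      volume 0 h := by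
    rw [intervalIntegrable_iff_integrableOn_Ioc_of_le h0.le]
    exact hprod.integral_prod_right
  rw [hswap, ← intervalIntegral.integral_of_le h0.le, Real.dist_eq]
  have hconst : I₀ = h⁻¹ * ∫ _ in 0..h, I₀ := by
    rw [intervalIntegral.integral_const, sub_zero, smul_eq_mul, inv_mul_cancel_left₀ h0.ne']
  rw [hconst, ← mul_sub, ← intervalIntegral.integral_sub hI
    (by exact intervalIntegrable_const), abs_mul, abs_of_pos (inv_pos.2 h0)]
  have hbd := intervalIntegral.norm_integral_le_of_norm_le_const (a := 0) (b := h)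
    (f := fun σ => (∫ t in Ioc 0 (T - h), g (t + σ) (zX (t + b))) - I₀) (C := ε / 2) (by
      intro σ hσ
      rw [uIoc_of_le h0.le] at hσ
      rw [Real.norm_eq_abs, ← intervalIntegral.integral_of_le hTh]
      exact hshift h h0 hlt hhT σ (Ioc_subset_Icc_self hσ) b hbm)
  rw [sub_zero, abs_of_pos h0, Real.norm_eq_abs] at hbd
  calc h⁻¹ * _ ≤ h⁻¹ * (ε / 2 * h) := by gcongr
    _ = ε / 2 := by field_simp
    _ < ε := half_lt_self hε

/-- The averaged increments of a continuous function over `[0, T]` converge to its total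
increment. -/
lemma tendsto_averaged_increment {f : ℝ → ℝ} (hf : ContinuousOn f (Icc 0 T)) (hT : 0 < T) :
    Tendsto (fun h => h⁻¹ * ∫ t in 0..(T - h), (f (t + h) - f t)) (𝓝[>] 0)
      (𝓝 (f T - f 0)) := by
  set F : ℝ → ℝ := IccExtend hT.le ((Icc 0 T).domRestrict f) with hF
  have hFc : Continuous F := (continuousOn_iff_continuous_domRestrict.1 hf).Icc_extend'
  have hFe : ∀ t ∈ Icc 0 T, F t = f t := fun t ht => IccExtend_of_mem hT.le _ ht
  set P : ℝ → ℝ := fun r => ∫ t in 0..r, F t with hP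
  have hPd : ∀ r, HasDerivAt P (F r) r := fun r =>
    intervalIntegral.integral_hasDerivAt_right (hFc.intervalIntegrable _ _)
      hFc.aestronglyMeasurable.stronglyMeasurableAtFilter hFc.continuousAt
  have hd : HasDerivAt (fun h => P T - P (T - h) - P h) (f T - f 0) 0 := by
    have h1 : HasDerivAt (fun h => P (T - h)) (-F T) 0 := by
      have := (hPd (T - 0)).comp_const_sub T 0
      simpa using this
    have h2 := ((hasDerivAt_const (0 : ℝ) (P T)).sub h1).sub (hPd 0)
    rw [hFe 0 ⟨le_rfl, hT.le⟩, hFe T ⟨hT.le, le_rfl⟩] at h2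
    convert! h2 using 1
    ring
  refine hd.tendsto_slope_zero_right.congr' ?_
  filter_upwards [Ioo_mem_nhdsGT hT] with h hh
  have hP0 : P 0 = 0 := by simp [hP]
  simp only [zero_add, sub_zero, hP0, sub_self, smul_eq_mul]
  congr 1
  have hcongr : ∫ t in 0..(T - h), (f (t + h) - f t) = ∫ t in 0..(T - h), (F (t + h) - F t) := by
    refine intervalIntegral.integral_congr fun t ht => ?_
    rw [uIcc_of_le (by linarith [hh.2])] at ht
    rw [hFe t ⟨ht.1, by linarith [ht.2, hh.1]⟩,
      hFe (t + h) ⟨by linarith [ht.1, hh.1], by linarith [ht.2]⟩]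
  rw [hcongr, intervalIntegral.integral_sub
    (f := fun t => F (t + h))
    ((hFc.comp (continuous_add_const h)).intervalIntegrable _ _) (hFc.intervalIntegrable _ _),
    intervalIntegral.integral_comp_add_right, zero_add, sub_add_cancel]
  have : P T - P h = ∫ t in h..T, F t :=
    intervalIntegral.integral_interval_sub_left (hFc.intervalIntegrable _ _)
      (hFc.intervalIntegrable _ _)
  rw [← this]
  simp only [hP]
  ring

/-- Integration by parts in time for two trajectories of class `C([0, T]; Y) ∩ L²(0, T; X)` whose
derivatives satisfy the test bound. It is the limit of the discrete product rule
`(w(t+h), z(t+h)) - (w(t), z(t)) = (w(t+h) - w(t), z(t+h)) + (z(t+h) - z(t), w(t))`. -/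
theorem integral_apply_add_integral_apply {g k : ℝ → StrongDual ℝ X} {wX zX : ℝ → X}
    {w z : ℝ → Y} (hT : 0 < T) (hw : IsTrajectory i T wX w) (hz : IsTrajectory i T zX z)
    (hg : HasTestBound i T g) (hk : HasTestBound i T k)
    (hwg : ∀ r ∈ Icc 0 T, ∀ s ∈ Icc 0 T, ∀ v, ⟪w s - w r, i v⟫ = (∫ t in r..s, g t) v)
    (hzk : ∀ r ∈ Icc 0 T, ∀ s ∈ Icc 0 T, ∀ v, ⟪z s - z r, i v⟫ = (∫ t in r..s, k t) v) :
    (∫ t in 0..T, g t (zX t)) + ∫ t in 0..T, k t (wX t) = ⟪w T, z T⟫ - ⟪w 0, z 0⟫ := by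
  have h1 := (hg.tendsto_difference_quotient hz hT hwg (c := 1) ⟨by norm_num, le_rfl⟩).add
    (hk.tendsto_difference_quotient hw hT hzk (c := 0) ⟨le_rfl, by norm_num⟩)
  have h2 := tendsto_averaged_increment (hw.continuousOn.inner (𝕜 := ℝ) hz.continuousOn) hT
  refine tendsto_nhds_unique h1 (h2.congr' ?_)
  filter_upwards [Ioo_mem_nhdsGT hT] with h hh
  have hTh : 0 ≤ T - h := by linarith [hh.2]
  have hsub : ∀ {u : ℝ → Y}, ContinuousOn u (Icc 0 T) →
      ContinuousOn u (Icc 0 (T - h)) ∧ ContinuousOn (fun t => u (t + h)) (Icc 0 (T - h)) := by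
    intro u hu
    refine ⟨hu.mono (Icc_subset_Icc le_rfl (by linarith [hh.1])),
      hu.comp (continuous_add_const h).continuousOn fun t ht => ?_⟩
    exact ⟨by linarith [ht.1, hh.1], by linarith [ht.2]⟩
  obtain ⟨w1, w2⟩ := hsub hw.continuousOn
  obtain ⟨z1, z2⟩ := hsub hz.continuousOn
  rw [← mul_add, ← intervalIntegral.integral_add]
  · congr 1
    refine intervalIntegral.integral_congr fun t _ => ?_
    simp only [one_mul, zero_mul, add_zero, inner_sub_left]
    rw [real_inner_comm (w t) (z (t + h)), real_inner_comm (w t) (z t)]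
    ring
  · simp only [one_mul]
    refine ContinuousOn.intervalIntegrable ?_
    rw [uIcc_of_le hTh]
    exact (w2.sub w1).inner z2
  · simp only [zero_mul, add_zero]
    refine ContinuousOn.intervalIntegrable ?_
    rw [uIcc_of_le hTh]
    exact (z2.sub z1).inner w1

end CBF

namespace CBF

variable {O : Set E2} {T : ℝ}

/-! ### Trajectories in `C([0, T]; ℍ) ∩ L²(0, T; 𝕍)` -/

lemma State.isTrajectory (u : State O T) : IsTrajectory (VtoH O) T u.inV u.inH :=
  ⟨u.2.1, u.2.2.1, u.2.2.2⟩

lemma State.memLp_inH (u : State O T) : MemLp u.inH 2 (timeMeasure T) :=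
  ((VtoH O).comp_memLp' u.2.2.1).ae_eq u.2.2.2

lemma State.memLp_grad (u : State O T) : MemLp (fun t => grad (u.inV t)) 2 (timeMeasure T) :=
  (gradL O).comp_memLp' u.2.2.1

lemma State.exists_bound (u : State O T) :
    ∃ M : ℝ, 0 ≤ M ∧ ∀ᵐ t ∂timeMeasure T, ‖VtoH O (u.inV t)‖ ≤ M := by
  obtain ⟨C, hC⟩ := isCompact_Icc.exists_bound_of_continuousOn u.2.1
  refine ⟨max C 0, le_max_right _ _, ?_⟩
  filter_upwards [u.2.2.2, ae_restrict_mem measurableSet_Ioc] with t h1 h2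
  change ‖VtoH O (u.1.2 t)‖ ≤ _
  rw [h1]
  exact (hC t (Ioc_subset_Icc_self h2)).trans (le_max_left _ _)

lemma continuous_HtoVDual : Continuous (HtoVDual O) := by
  unfold HtoVDual
  exact (innerSL ℝ).continuous.clm_comp continuous_const

/-- Increments of a trajectory with an integrable weak time derivative. -/
lemma HasWeakTimeDeriv.inner_sub_eq {u : State O T} {g : ℝ → VDual O} (hT : 0 < T)
    (hu : HasWeakTimeDeriv u g) (hg : HasTestBound (VtoH O) T g) :
    ∀ r ∈ Icc 0 T, ∀ s ∈ Icc 0 T, ∀ v, ⟪u.inH s - u.inH r, VtoH O v⟫ = (∫ t in r..s, g t) v := by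
  intro r hr s hs v
  have h := sub_eq_integral_of_weakDeriv hT
    (continuous_HtoVDual.comp_continuousOn u.2.1) hg.integrableOn hu hr hs
  rw [← h, inner_sub_left]
  rfl

/-- `𝕍` is dense in `ℍ`. -/
lemma eq_zero_of_inner_VtoH_eq_zero {h : H O} (hz : ∀ v : V O, ⟪h, VtoH O v⟫ = 0) : h = 0 := by
  have hcl : ∀ y ∈ HSub O, ⟪(h : L2Vec O), y⟫ = 0 := by
    intro y hy
    have hclosed : IsClosed {y : L2Vec O | ⟪(h : L2Vec O), y⟫ = 0} :=
      isClosed_eq (by fun_prop) continuous_const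
    refine closure_minimal ?_ hclosed hy
    rintro _ ⟨φ, rfl⟩
    exact hz ⟨testToH1 O φ, subset_closure ⟨φ, rfl⟩⟩
  have h0 : ⟪(h : L2Vec O), (h : L2Vec O)⟫ = 0 := hcl _ h.2
  exact Subtype.ext (inner_self_eq_zero.1 h0)

variable {𝕌 : Type*} [NormedAddCommGroup 𝕌] [InnerProductSpace ℝ 𝕌]

/-- The weakly attained initial value is the value at time `0` of the continuous trajectory. -/
lemma IsWeakSolution.inH_zero {μ α β : ℝ} {D : 𝕌 →L[ℝ] VDual O} {f : ℝ → VDual O} {u₀ : H O}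
    {u : State O T} {U : Control T 𝕌} (hT : 0 < T) (hu : IsWeakSolution μ α β D f u₀ u U) :
    u.inH 0 = u₀ := by
  rw [← sub_eq_zero]
  refine eq_zero_of_inner_VtoH_eq_zero fun v => ?_
  have h1 : Tendsto u.inH (𝓝[>] 0) (𝓝 (u.inH 0)) :=
    (u.2.1 0 ⟨le_rfl, hT.le⟩).mono_left
      (nhdsWithin_le_of_mem (mem_of_superset (Ioo_mem_nhdsGT hT) Ioo_subset_Icc_self))
  have h2 : Tendsto (fun t => ⟪u.inH t, VtoH O v⟫) (𝓝[>] 0) (𝓝 ⟪u.inH 0, VtoH O v⟫) :=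
    h1.inner tendsto_const_nhds
  rw [inner_sub_left, tendsto_nhds_unique h2 (hu.initial v), sub_self]

/-! ### The time derivatives satisfy the test bound -/

lemma HasTestBound.sub {X Y : Type*} [NormedAddCommGroup X] [NormedSpace ℝ X]
    [NormedAddCommGroup Y] [InnerProductSpace ℝ Y] {i : X →L[ℝ] Y} {g k : ℝ → StrongDual ℝ X}
    (hg : HasTestBound i T g) (hk : HasTestBound i T k) :
    HasTestBound i T (fun t => g t - k t) := by
  refine ⟨hg.integrableOn.sub hk.integrableOn, ?_⟩
  obtain ⟨m₁, K₁, h1, h2, h3, h4⟩ := hg.exists_bound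
  obtain ⟨m₂, K₂, k1, k2, k3, k4⟩ := hk.exists_bound
  refine ⟨fun t => m₁ t + m₂ t, K₁ + K₂, fun t => add_nonneg (h1 t) (k1 t), add_nonneg h2 k2,
    h3.add k3, ?_⟩
  filter_upwards [h4, k4] with t a b v
  have e1 : m₁ t * ‖v‖ + m₁ t ^ 2 * ‖i v‖ ≤
      (m₁ t + m₂ t) * ‖v‖ + (m₁ t + m₂ t) ^ 2 * ‖i v‖ := by
    have := h1 t
    have := k1 t
    gcongr <;> linarith
  have e2 : m₂ t * ‖v‖ + m₂ t ^ 2 * ‖i v‖ ≤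
      (m₁ t + m₂ t) * ‖v‖ + (m₁ t + m₂ t) ^ 2 * ‖i v‖ := by
    have := h1 t
    have := k1 t
    gcongr <;> linarith
  calc |(g t - k t) v| ≤ |g t v| + |k t v| := abs_sub _ _
    _ ≤ K₁ * ((m₁ t + m₂ t) * ‖v‖ + (m₁ t + m₂ t) ^ 2 * ‖i v‖)
        + K₂ * ((m₁ t + m₂ t) * ‖v‖ + (m₁ t + m₂ t) ^ 2 * ‖i v‖) :=
      add_le_add ((a v).trans (by gcongr)) ((b v).trans (by gcongr))
    _ = _ := by ring

lemma integrableOn_of_memLp_four_thirds {X : Type*} [NormedAddCommGroup X] [NormedSpace ℝ X]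
    {g : ℝ → StrongDual ℝ X} (hg : MemLp g (4 / 3) (timeMeasure T)) : IntegrableOn g (Ioc 0 T) := by
  refine hg.integrable ?_
  rw [ENNReal.le_div_iff_mul_le (by norm_num) (by norm_num)]
  norm_num

lemma abs_stokesForm_le (u v : V O) : |stokesForm u v| ≤ ‖u‖ * ‖v‖ :=
  (abs_real_inner_le_norm _ _).trans
    (mul_le_mul (norm_grad_le u) (norm_grad_le v) (norm_nonneg _) (norm_nonneg _))

lemma mul_norm_le_testBound {x m : ℝ} (h : x ≤ m) (v : V O) : x * ‖v‖ ≤ testBound m v := by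
  have : 0 ≤ m ^ 2 * ‖VtoH O v‖ := by positivity
  rw [testBound]
  nlinarith [norm_nonneg v]

/-- Stated over a general normed space, in which the instances on the dual are found directly;
so is `exists_abs_apply_le`. -/
lemma memLp_norm_functional {X : Type*} [NormedAddCommGroup X] [NormedSpace ℝ X]
    {ν : Measure ℝ} {g : ℝ → StrongDual ℝ X} (hg : MemLp g 2 ν) : MemLp (fun t => ‖g t‖) 2 ν :=
  hg.norm

lemma exists_abs_apply_le {E X : Type*} [NormedAddCommGroup E] [NormedSpace ℝ E]
    [NormedAddCommGroup X] [NormedSpace ℝ X] (D : E →L[ℝ] StrongDual ℝ X) :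
    ∃ K : ℝ, 0 ≤ K ∧ ∀ U v, |D U v| ≤ K * (‖U‖ * ‖v‖) :=
  ⟨‖D‖, norm_nonneg D, fun U v => by
    rw [← mul_assoc]
    exact D.le_opNorm₂ U v⟩

/-- The time derivative of a weak solution satisfies the test bound, with
`m = ‖u‖_𝕍 + ‖f‖ + ‖U‖`. -/
lemma hasTestBound_of_stateEquation {μ α β : ℝ} (hμ : 0 ≤ μ) (hα : 0 ≤ α) (hβ : 0 ≤ β)
    {D : 𝕌 →L[ℝ] VDual O} {f : ℝ → VDual O} (hf : MemLp f 2 (timeMeasure T))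
    {u : State O T} {U : Control T 𝕌} {g : ℝ → VDual O} (hg : MemLp g (4 / 3) (timeMeasure T))
    (heq : ∀ᵐ t ∂timeMeasure T, ∀ v : V O,
      g t v + μ * stokesForm (u.inV t) v + trilin (u.inV t) (u.inV t) v
        + α * ⟪u.inH t, VtoH O v⟫ + β * cubicForm (u.inV t) v = f t v + D (U t) v) :
    HasTestBound (VtoH O) T g := by
  refine ⟨integrableOn_of_memLp_four_thirds hg, ?_⟩
  obtain ⟨M, hM, hMb⟩ := u.exists_bound
  obtain ⟨K, hK, hKb⟩ := exists_abs_apply_le D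
  set L : ℝ := ladyzhenskayaConst * (1 + M) with hL
  have hL0 : 0 ≤ L := by positivity
  refine ⟨fun t => ‖u.inV t‖ + ‖f t‖ + ‖U t‖, μ + L + α + β * L ^ 2 + 1 + K,
    fun t => by positivity, by positivity,
    (u.2.2.1.norm.add (memLp_norm_functional hf)).add (Lp.memLp U).norm, ?_⟩
  filter_upwards [heq, hMb, u.2.2.2] with t h1 h2 h3 v
  set m := ‖u.inV t‖ + ‖f t‖ + ‖U t‖ with hm
  have n1 := norm_nonneg (u.inV t)
  have n2 := norm_nonneg (f t)
  have n3 := norm_nonneg (U t)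
  have hum : ‖u.inV t‖ ≤ m := by linarith
  have hfm : ‖f t‖ ≤ m := by linarith
  have hUm : ‖U t‖ ≤ m := by linarith
  have hgv : g t v = f t v + D (U t) v - μ * stokesForm (u.inV t) v
      - trilin (u.inV t) (u.inV t) v - α * ⟪u.inH t, VtoH O v⟫ - β * cubicForm (u.inV t) v := by
    linarith [h1 v]
  have b1 : |stokesForm (u.inV t) v| ≤ testBound m v :=
    (abs_stokesForm_le _ _).trans (mul_norm_le_testBound hum v)
  have b2 : |trilin (u.inV t) (u.inV t) v| ≤ L * testBound m v := abs_trilin_test_le h2 hum hum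
  have b3 : |⟪u.inH t, VtoH O v⟫| ≤ testBound m v := by
    have h3' : u.inH t = VtoH O (u.inV t) := h3.symm
    rw [h3']
    refine (abs_real_inner_le_norm _ _).trans (le_trans ?_ (mul_norm_le_testBound hum v))
    exact mul_le_mul (norm_VtoH_le _) (norm_VtoH_le _) (norm_nonneg _) (norm_nonneg _)
  have b4 : |cubicForm (u.inV t) v| ≤ L ^ 2 * testBound m v := by
    rw [cubicForm_eq]
    exact abs_quadForm_test_le h2 hum h2 hum h2 hum
  have b5 : |f t v| ≤ testBound m v :=
    ((f t).le_opNorm v).trans (mul_norm_le_testBound hfm v)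
  have b6 : |D (U t) v| ≤ K * testBound m v :=
    (hKb (U t) v).trans (mul_le_mul_of_nonneg_left (mul_norm_le_testBound hUm v) hK)
  have c1 : |μ * stokesForm (u.inV t) v| ≤ μ * testBound m v := by
    rw [abs_mul, abs_of_nonneg hμ]
    gcongr
  have c3 : |α * ⟪u.inH t, VtoH O v⟫| ≤ α * testBound m v := by
    rw [abs_mul, abs_of_nonneg hα]
    gcongr
  have c4 : |β * cubicForm (u.inV t) v| ≤ β * (L ^ 2 * testBound m v) := by
    rw [abs_mul, abs_of_nonneg hβ]
    gcongr
  change |g t v| ≤ _ * testBound m v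
  rw [hgv]
  rw [abs_le] at *
  exact ⟨by linarith [b2.1, b5.1, b6.1, c1.1, c3.1, c4.1, b2.2, b5.2, b6.2, c1.2, c3.2, c4.2],
    by linarith [b2.1, b5.1, b6.1, c1.1, c3.1, c4.1, b2.2, b5.2, b6.2, c1.2, c3.2, c4.2]⟩

/-- The time derivative of an adjoint state satisfies the test bound, with
`m = ‖u‖_𝕍 + ‖p‖_𝕍 + ‖u_d‖_ℍ`. -/
lemma hasTestBound_of_adjointEquation {μ α β : ℝ} (hμ : 0 ≤ μ) (hα : 0 ≤ α) (hβ : 0 ≤ β)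
    {ud : ℝ → H O} (hud : MemLp ud 2 (timeMeasure T))
    {u p : State O T} {g : ℝ → VDual O} (hg : MemLp g (4 / 3) (timeMeasure T))
    (heq : ∀ᵐ t ∂timeMeasure T, ∀ q : V O,
      -g t q + μ * stokesForm (p.inV t) q
        + (trilin (u.inV t) q (p.inV t) + trilin q (u.inV t) (p.inV t))
        + α * ⟪p.inH t, VtoH O q⟫ + β * cubicDerivForm (u.inV t) (p.inV t) q
      = ⟪u.inH t - ud t, VtoH O q⟫ + stokesForm (u.inV t) q) :
    HasTestBound (VtoH O) T g := by
  refine ⟨integrableOn_of_memLp_four_thirds hg, ?_⟩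
  obtain ⟨M₁, hM₁, hMb₁⟩ := u.exists_bound
  obtain ⟨M₂, hM₂, hMb₂⟩ := p.exists_bound
  set M := M₁ + M₂ with hM
  set L : ℝ := ladyzhenskayaConst * (1 + M) with hL
  have hL0 : 0 ≤ L := by positivity
  refine ⟨fun t => ‖u.inV t‖ + ‖p.inV t‖ + ‖ud t‖, μ + 2 * L + α + β * (3 * L ^ 2) + 2,
    fun t => by positivity, by positivity,
    (u.2.2.1.norm.add p.2.2.1.norm).add hud.norm, ?_⟩
  filter_upwards [heq, hMb₁, hMb₂, u.2.2.2, p.2.2.2] with t h1 h2 h3 h4 h5 q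
  set m := ‖u.inV t‖ + ‖p.inV t‖ + ‖ud t‖ with hm
  have n1 := norm_nonneg (u.inV t)
  have n2 := norm_nonneg (p.inV t)
  have n3 := norm_nonneg (ud t)
  have hum : ‖u.inV t‖ ≤ m := by linarith
  have hpm : ‖p.inV t‖ ≤ m := by linarith
  have huM : ‖VtoH O (u.inV t)‖ ≤ M := by linarith
  have hpM : ‖VtoH O (p.inV t)‖ ≤ M := by linarith
  have hgv : g t q = μ * stokesForm (p.inV t) q
        + (trilin (u.inV t) q (p.inV t) + trilin q (u.inV t) (p.inV t))
        + α * ⟪p.inH t, VtoH O q⟫ + β * cubicDerivForm (u.inV t) (p.inV t) q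
      - ⟪u.inH t - ud t, VtoH O q⟫ - stokesForm (u.inV t) q := by
    linarith [h1 q]
  have b1 : |stokesForm (p.inV t) q| ≤ testBound m q :=
    (abs_stokesForm_le _ _).trans (mul_norm_le_testBound hpm q)
  have b2 : |stokesForm (u.inV t) q| ≤ testBound m q :=
    (abs_stokesForm_le _ _).trans (mul_norm_le_testBound hum q)
  have b3 : |trilin (u.inV t) q (p.inV t)| ≤ L * testBound m q :=
    abs_trilin_test_mid_le huM hum hpM hpm
  have b4 : |trilin q (u.inV t) (p.inV t)| ≤ L * testBound m q :=
    abs_trilin_test_left_le hpM hpm hum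
  have b5 : |⟪p.inH t, VtoH O q⟫| ≤ testBound m q := by
    have h5' : p.inH t = VtoH O (p.inV t) := h5.symm
    rw [h5']
    refine (abs_real_inner_le_norm _ _).trans (le_trans ?_ (mul_norm_le_testBound hpm q))
    exact mul_le_mul (norm_VtoH_le _) (norm_VtoH_le _) (norm_nonneg _) (norm_nonneg _)
  have b6 : |⟪u.inH t - ud t, VtoH O q⟫| ≤ testBound m q := by
    have h4' : u.inH t = VtoH O (u.inV t) := h4.symm
    rw [h4']
    have e : ‖VtoH O (u.inV t) - ud t‖ ≤ m := by
      have e1 := norm_sub_le (VtoH O (u.inV t)) (ud t)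
      have e2 := norm_VtoH_le (u.inV t)
      linarith
    refine (abs_real_inner_le_norm _ _).trans (le_trans ?_ (mul_norm_le_testBound e q))
    gcongr
    exact norm_VtoH_le q
  have b7 : |cubicDerivForm (u.inV t) (p.inV t) q| ≤ 3 * L ^ 2 * testBound m q := by
    rw [cubicDerivForm_eq]
    have e1 : |quadForm (u.inV t) (u.inV t) (p.inV t) q| ≤ L ^ 2 * testBound m q :=
      abs_quadForm_test_le huM hum huM hum hpM hpm
    have e2 : |quadForm (u.inV t) (p.inV t) (u.inV t) q| ≤ L ^ 2 * testBound m q :=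
      abs_quadForm_test_le huM hum hpM hpm huM hum
    rw [abs_le] at *
    exact ⟨by linarith [e1.1, e2.1], by linarith [e1.2, e2.2]⟩
  have c1 : |μ * stokesForm (p.inV t) q| ≤ μ * testBound m q := by
    rw [abs_mul, abs_of_nonneg hμ]
    gcongr
  have c5 : |α * ⟪p.inH t, VtoH O q⟫| ≤ α * testBound m q := by
    rw [abs_mul, abs_of_nonneg hα]
    gcongr
  have c7 : |β * cubicDerivForm (u.inV t) (p.inV t) q| ≤ β * (3 * L ^ 2 * testBound m q) := by
    rw [abs_mul, abs_of_nonneg hβ]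
    gcongr
  change |g t q| ≤ _ * testBound m q
  rw [hgv]
  rw [abs_le] at *
  exact ⟨by linarith [b2.1, b3.1, b4.1, b6.1, c1.1, c5.1, c7.1, b2.2, b6.2],
    by linarith [b2.1, b6.1, b2.2, b3.2, b4.2, b6.2, c1.2, c5.2, c7.2]⟩

/-! ### Integrability of the nonlinear terms in time -/

lemma testBound_le {M m : ℝ} {v : V O} (hvH : ‖VtoH O v‖ ≤ M) (hv : ‖v‖ ≤ m) :
    testBound m v ≤ (1 + M) * m ^ 2 := by
  have hm : 0 ≤ m := (norm_nonneg v).trans hv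
  rw [testBound]
  nlinarith [mul_le_mul_of_nonneg_left hv hm, mul_le_mul_of_nonneg_left hvH (sq_nonneg m)]

lemma integrableOn_trilin (a b c : State O T) :
    IntegrableOn (fun t => trilin (a.inV t) (b.inV t) (c.inV t)) (Ioc 0 T) := by
  obtain ⟨M₁, hM₁, hMb₁⟩ := a.exists_bound
  obtain ⟨M₂, hM₂, hMb₂⟩ := c.exists_bound
  have hm : MemLp (fun t => ‖a.inV t‖ + ‖b.inV t‖ + ‖c.inV t‖) 2 (timeMeasure T) :=
    (a.2.2.1.norm.add b.2.2.1.norm).add c.2.2.1.norm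
  refine ((hm.integrable_sq.const_mul (1 + (M₁ + M₂))).const_mul
    (ladyzhenskayaConst * (1 + (M₁ + M₂)))).mono'
    (aestronglyMeasurable_trilin a.2.2.1.1 b.2.2.1.1 c.2.2.1.1) ?_
  filter_upwards [hMb₁, hMb₂] with t h1 h2
  have n1 := norm_nonneg (a.inV t)
  have n2 := norm_nonneg (b.inV t)
  have n3 := norm_nonneg (c.inV t)
  refine (abs_trilin_test_le (M := M₁ + M₂) (m := ‖a.inV t‖ + ‖b.inV t‖ + ‖c.inV t‖)
    (by linarith) (by linarith) (by linarith)).trans ?_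
  gcongr
  exact testBound_le (by linarith) (by linarith)

lemma integrableOn_quadForm (a b c d : State O T) :
    IntegrableOn (fun t => quadForm (a.inV t) (b.inV t) (c.inV t) (d.inV t)) (Ioc 0 T) := by
  obtain ⟨M₁, hM₁, hMb₁⟩ := a.exists_bound
  obtain ⟨M₂, hM₂, hMb₂⟩ := b.exists_bound
  obtain ⟨M₃, hM₃, hMb₃⟩ := c.exists_bound
  obtain ⟨M₄, hM₄, hMb₄⟩ := d.exists_bound
  have hm : MemLp (fun t => ‖a.inV t‖ + ‖b.inV t‖ + ‖c.inV t‖ + ‖d.inV t‖) 2 (timeMeasure T) :=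
    ((a.2.2.1.norm.add b.2.2.1.norm).add c.2.2.1.norm).add d.2.2.1.norm
  refine ((hm.integrable_sq.const_mul (1 + (M₁ + M₂ + M₃ + M₄))).const_mul
    ((ladyzhenskayaConst * (1 + (M₁ + M₂ + M₃ + M₄))) ^ 2)).mono'
    (aestronglyMeasurable_quadForm a.2.2.1.1 b.2.2.1.1 c.2.2.1.1 d.2.2.1.1) ?_
  filter_upwards [hMb₁, hMb₂, hMb₃, hMb₄] with t h1 h2 h3 h4
  have n1 := norm_nonneg (a.inV t)
  have n2 := norm_nonneg (b.inV t)
  have n3 := norm_nonneg (c.inV t)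
  have n4 := norm_nonneg (d.inV t)
  refine (abs_quadForm_test_le (M := M₁ + M₂ + M₃ + M₄)
    (m := ‖a.inV t‖ + ‖b.inV t‖ + ‖c.inV t‖ + ‖d.inV t‖)
    (by linarith) (by linarith) (by linarith) (by linarith) (by linarith)
    (by linarith)).trans ?_
  gcongr
  exact testBound_le (by linarith) (by linarith)

lemma integrableOn_cubicRemainderForm (a w p : State O T) :
    IntegrableOn (fun t => cubicRemainderForm (a.inV t) (w.inV t) (p.inV t)) (Ioc 0 T) := by
  simp only [cubicRemainderForm_eq]
  exact (((integrableOn_quadForm a w w p).const_mul 2).add (integrableOn_quadForm w w w p)).add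
    (integrableOn_quadForm w w a p)

/-! ### The cost difference -/

lemma integrable_sq_of_memLp {E : Type*} [NormedAddCommGroup E] {ν : Measure ℝ} {u : ℝ → E}
    (hu : MemLp u 2 ν) : Integrable (fun t => ‖u t‖ ^ 2) ν :=
  (memLp_two_iff_integrable_sq_norm hu.1).1 hu

/-- The running cost at a fixed time, expanded at a reference state `u` and control `U` with
increments `w` and `W`. The hypotheses are the two state equations tested with the adjoint state
`p`, the adjoint equation tested with `w`, and the first order condition. -/
lemma runningCost_add_eq [CompleteSpace 𝕌] {μ α β : ℝ} {D : 𝕌 →L[ℝ] VDual O} {u w p : V O}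
    {d : H O} {U W : 𝕌} {a b c e : ℝ}
    (h1 : a + μ * stokesForm u p + trilin u u p + α * ⟪VtoH O u, VtoH O p⟫
      + β * cubicForm u p = e + D U p)
    (h2 : b + μ * stokesForm (u + w) p + trilin (u + w) (u + w) p
      + α * ⟪VtoH O (u + w), VtoH O p⟫ + β * cubicForm (u + w) p = e + D (U + W) p)
    (h3 : -c + μ * stokesForm p w + (trilin u w p + trilin w u p)
      + α * ⟪VtoH O p, VtoH O w⟫ + β * cubicDerivForm u p w
      = ⟪VtoH O u - d, VtoH O w⟫ + stokesForm u w)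
    (h4 : U = -controlAdjoint D p) :
    ‖VtoH O (u + w) - d‖ ^ 2 + ‖grad (u + w)‖ ^ 2 + ‖U + W‖ ^ 2 =
      (‖VtoH O u - d‖ ^ 2 + ‖grad u‖ ^ 2 + ‖U‖ ^ 2)
      + (‖VtoH O w‖ ^ 2 + ‖grad w‖ ^ 2 + ‖W‖ ^ 2)
      - 2 * (trilin w w p + β * cubicRemainderForm u w p + ((b - a) + c)) := by
  have htri := trilin_expand u w p
  have hcub : β * cubicForm (u + w) p =
      β * cubicForm u p + β * cubicDerivForm u p w + β * cubicRemainderForm u w p := by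
    rw [← mul_add, ← mul_add]
    congr 1
    linarith [cubicForm_expand u w p]
  have hst : stokesForm (u + w) p = stokesForm u p + stokesForm p w := by
    rw [stokesForm, stokesForm, stokesForm, grad_add, inner_add_left, real_inner_comm (grad w)]
  have hDW : ⟪U, W⟫ = -(D W p) := by
    rw [h4, inner_neg_left, real_inner_comm, inner_controlAdjoint]
  have hDadd : D (U + W) p = D U p + D W p := by
    rw [map_add]
    rfl
  rw [hcub, hst, hDadd, map_add, inner_add_left, real_inner_comm (VtoH O p) (VtoH O w)] at h2
  have s1 : ‖VtoH O (u + w) - d‖ ^ 2 =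
      ‖VtoH O u - d‖ ^ 2 + 2 * ⟪VtoH O u - d, VtoH O w⟫ + ‖VtoH O w‖ ^ 2 := by
    rw [← norm_add_sq_real, map_add]
    congr 2
    abel
  have s2 : ‖grad (u + w)‖ ^ 2 = ‖grad u‖ ^ 2 + 2 * stokesForm u w + ‖grad w‖ ^ 2 := by
    rw [stokesForm, ← norm_add_sq_real, grad_add]
  rw [s1, s2, norm_add_sq_real U W, hDW]
  linarith

/-- The cost difference of two admissible pairs is the second order expression at their
difference: the first order terms cancel by the state equations, the adjoint equation and the
first order condition. -/
theorem cost_sub_cost_eq [CompleteSpace 𝕌] {μ α β : ℝ} (hT : 0 < T) (hμ : 0 ≤ μ) (hα : 0 ≤ α)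
    (hβ : 0 ≤ β) {D : 𝕌 →L[ℝ] VDual O} {f : ℝ → VDual O} (hf : MemLp f 2 (timeMeasure T))
    {u₀ : H O} {ud : ℝ → H O} (hud : MemLp ud 2 (timeMeasure T)) {uf : H O}
    {q q' : State O T × Control T 𝕌} {p : State O T}
    (hq : q ∈ admissible T μ α β D f u₀) (hq' : q' ∈ admissible T μ α β D f u₀)
    (hp : IsAdjointSolution μ α β ud uf q.1 p) (hfirst : FirstOrderCondition D p q.2) :
    cost ud uf q' - cost ud uf q = secondOrderForm β q.1 p (q' - q) := by
  obtain ⟨u, U⟩ := q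
  obtain ⟨u', U'⟩ := q'
  have hs : IsWeakSolution μ α β D f u₀ u U := hq
  have hs' : IsWeakSolution μ α β D f u₀ u' U' := hq'
  obtain ⟨g, hg, hgd, hge⟩ := hs.equation
  obtain ⟨g', hg', hgd', hge'⟩ := hs'.equation
  obtain ⟨k, hk, hkd, hke⟩ := hp.equation
  have tg := hasTestBound_of_stateEquation hμ hα hβ hf hg hge
  have tg' := hasTestBound_of_stateEquation hμ hα hβ hf hg' hge'
  have tk := hasTestBound_of_adjointEquation hμ hα hβ hud hk hke
  have tw := tg'.sub tg
  set w : State O T := u' - u with hw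
  have hwH : ∀ t, w.inH t = u'.inH t - u.inH t := fun t => rfl
  have hwV : ∀ t, w.inV t = u'.inV t - u.inV t := fun t => rfl
  have hinc : ∀ r ∈ Icc 0 T, ∀ s ∈ Icc 0 T, ∀ v,
      ⟪w.inH s - w.inH r, VtoH O v⟫ = (∫ t in r..s, (g' t - g t)) v := by
    intro r hr s hs v
    rw [intervalIntegral.integral_sub (tg'.intervalIntegrable hT hr hs)
      (tg.intervalIntegrable hT hr hs), _root_.sub_apply,
      ← hgd'.inner_sub_eq hT tg' r hr s hs v,
      ← hgd.inner_sub_eq hT tg r hr s hs v, ← inner_sub_left, hwH, hwH]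
    congr 1
    abel
  have hparts := integral_apply_add_integral_apply hT w.isTrajectory p.isTrajectory tw tk hinc
    (hkd.inner_sub_eq hT tk)
  have hw0 : w.inH 0 = 0 := by
    rw [hwH, hs'.inH_zero hT, hs.inH_zero hT, sub_self]
  rw [hw0, inner_zero_left, sub_zero, hp.final] at hparts
  have igw := tw.integrableOn_apply p.isTrajectory
  have igk := tk.integrableOn_apply w.isTrajectory
  have itri := integrableOn_trilin w w p
  have icub := integrableOn_cubicRemainderForm u w p
  have iH : ∀ v : State O T, Integrable (fun t => ‖v.inH t - ud t‖ ^ 2) (timeMeasure T) :=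
    fun v => integrable_sq_of_memLp (v.memLp_inH.sub hud)
  have iw : Integrable (fun t => ‖w.inH t‖ ^ 2) (timeMeasure T) :=
    integrable_sq_of_memLp w.memLp_inH
  have iV : ∀ v : State O T, Integrable (fun t => ‖grad (v.inV t)‖ ^ 2) (timeMeasure T) :=
    fun v => integrable_sq_of_memLp v.memLp_grad
  have iU : ∀ W : Control T 𝕌, Integrable (fun t => ‖W t‖ ^ 2) (timeMeasure T) :=
    fun W => integrable_sq_of_memLp (Lp.memLp W)
  have hpoint : ∀ᵐ t ∂timeMeasure T,
      ‖u'.inH t - ud t‖ ^ 2 + ‖grad (u'.inV t)‖ ^ 2 + ‖U' t‖ ^ 2 =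
        (‖u.inH t - ud t‖ ^ 2 + ‖grad (u.inV t)‖ ^ 2 + ‖U t‖ ^ 2)
        + (‖w.inH t‖ ^ 2 + ‖grad (w.inV t)‖ ^ 2 + ‖(U' - U) t‖ ^ 2)
        - 2 * (trilin (w.inV t) (w.inV t) (p.inV t)
          + β * cubicRemainderForm (u.inV t) (w.inV t) (p.inV t)
          + ((g' t - g t) (p.inV t) + k t (w.inV t))) := by
    filter_upwards [hge, hge', hke, hfirst, Lp.coeFn_sub U' U, p.2.2.2, w.2.2.2,
      u.2.2.2, u'.2.2.2] with t e1 e2 e3 e4 e5 e6 e7 e8 e9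
    have f0 : VtoH O (u.inV t) = u.inH t := e8
    have f1 := e1 (p.inV t)
    have f2 := e2 (p.inV t)
    have f3 := e3 (w.inV t)
    have hu' : u'.inV t = u.inV t + w.inV t := by
      rw [hwV]
      abel
    have f4 : VtoH O (u.inV t + w.inV t) = u'.inH t := by
      rw [← hu']
      exact e9
    have f6 : VtoH O (p.inV t) = p.inH t := e6
    have f7 : VtoH O (w.inV t) = w.inH t := e7
    have hU' : U' t = U t + (U' - U) t := by
      rw [e5, Pi.sub_apply]
      abel
    rw [hu', hU', ← f4] at f2
    rw [← f0] at f1 f3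
    rw [← f6] at f3
    have key := runningCost_add_eq (d := ud t) f1 f2 f3 e4
    rw [← hU', ← hu'] at key
    rw [← hu'] at f4
    rw [f4, f0, f7] at key
    exact key
  have hint := integral_congr_ae hpoint
  have iA : ∀ (v : State O T) (W : Control T 𝕌), Integrable
      (fun t => ‖v.inH t - ud t‖ ^ 2 + ‖grad (v.inV t)‖ ^ 2 + ‖W t‖ ^ 2) (timeMeasure T) :=
    fun v W => ((iH v).add (iV v)).add (iU W)
  have iS : Integrable (fun t => ‖w.inH t‖ ^ 2 + ‖grad (w.inV t)‖ ^ 2 + ‖(U' - U) t‖ ^ 2)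
      (timeMeasure T) := (iw.add (iV w)).add (iU (U' - U))
  have iTR : Integrable (fun t => trilin (w.inV t) (w.inV t) (p.inV t)
      + β * cubicRemainderForm (u.inV t) (w.inV t) (p.inV t)) (timeMeasure T) :=
    itri.add (icub.const_mul β)
  have iG : Integrable (fun t => (g' t - g t) (p.inV t) + k t (w.inV t)) (timeMeasure T) :=
    igw.add igk
  have iAS : Integrable (fun t => (‖u.inH t - ud t‖ ^ 2 + ‖grad (u.inV t)‖ ^ 2 + ‖U t‖ ^ 2)
      + (‖w.inH t‖ ^ 2 + ‖grad (w.inV t)‖ ^ 2 + ‖(U' - U) t‖ ^ 2)) (timeMeasure T) :=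
    (iA u U).add iS
  have iTRG : Integrable (fun t => 2 * (trilin (w.inV t) (w.inV t) (p.inV t)
      + β * cubicRemainderForm (u.inV t) (w.inV t) (p.inV t)
      + ((g' t - g t) (p.inV t) + k t (w.inV t)))) (timeMeasure T) :=
    (iTR.add iG).const_mul 2
  rw [integral_sub iAS iTRG, integral_add (iA u U) iS,
    integral_const_mul, integral_add iTR iG, integral_add itri (icub.const_mul β),
    integral_const_mul, integral_add igw igk] at hint
  have hcost : ∀ (v : State O T) (W : Control T 𝕌), cost ud uf (v, W) =
      1 / 2 * (∫ t in Ioc 0 T, (‖v.inH t - ud t‖ ^ 2 + ‖grad (v.inV t)‖ ^ 2 + ‖W t‖ ^ 2))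
        + 1 / 2 * ‖v.inH T - uf‖ ^ 2 := by
    intro v W
    have iHV : Integrable (fun t => ‖v.inH t - ud t‖ ^ 2 + ‖grad (v.inV t)‖ ^ 2)
        (timeMeasure T) := (iH v).add (iV v)
    rw [integral_add iHV (iU W), integral_add (iH v) (iV v)]
    simp only [cost, intervalIntegral.integral_of_le hT.le]
    ring
  have hfin : ‖u'.inH T - uf‖ ^ 2 =
      ‖u.inH T - uf‖ ^ 2 + 2 * ⟪w.inH T, u.inH T - uf⟫ + ‖w.inH T‖ ^ 2 := by
    rw [real_inner_comm, ← norm_add_sq_real, hwH]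
    congr 2
    abel
  rw [hcost, hcost]
  have hdiff : ((u', U') - (u, U) : State O T × Control T 𝕌) = (w, U' - U) := rfl
  rw [hdiff, secondOrderForm]
  simp only [intervalIntegral.integral_of_le hT.le] at hparts ⊢
  rw [hfin, hint, ← hparts]
  ring

end CBF

end

theorem mainTheorem5 (O : Set CBF.E2) (hO : IsOpen O) (hOc : IsConnected O)
    (hOb : Bornology.IsBounded O) (T : ℝ) (hT : 0 < T)
    (μ α β : ℝ) (hμ : 0 < μ) (hα : 0 ≤ α) (hβ : 0 ≤ β)
    {𝕌 : Type*} [NormedAddCommGroup 𝕌] [InnerProductSpace ℝ 𝕌] [CompleteSpace 𝕌]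
    [TopologicalSpace.SeparableSpace 𝕌]
    (D : 𝕌 →L[ℝ] CBF.VDual O)
    (f : ℝ → CBF.VDual O) (hf : MemLp f 2 (CBF.timeMeasure T)) (u₀ : CBF.H O)
    (ud : ℝ → CBF.H O) (hud : MemLp ud 2 (CBF.timeMeasure T)) (uf : CBF.H O)
    (uStar : CBF.State O T) (UStar : CBF.Control T 𝕌)
    (hfeas : (uStar, UStar) ∈ CBF.admissible T μ α β D f u₀)
    (p : CBF.State O T) (hp : CBF.IsAdjointSolution μ α β ud uf uStar p)
    (hfirst : CBF.FirstOrderCondition D p UStar)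
    (hsecond : ∀ q ∈ CBF.feasibleDifferences T μ α β D f u₀ (uStar, UStar),
      0 ≤ CBF.secondOrderForm β uStar p q) :
    CBF.IsOptimalPair μ α β D f u₀ ud uf (uStar, UStar) := by
  refine ⟨hfeas, fun q hq => ?_⟩
  have h := CBF.cost_sub_cost_eq hT hμ.le hα hβ hf hud hfeas hq hp hfirst
  have h0 := hsecond (q - (uStar, UStar)) (sub_mem_sub hq (mem_singleton _))
  rw [← h] at h0
  exact sub_nonneg.1 h0
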